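/- For $\mu\in\mathbb{R}$, $\nu\in\mathbb{C}$ and $x>0$, let $W_{\mu,\nu}(x)$ be the Whittaker function, i.e. the unique solution on $(0,\infty)$ of $u''+\left(-\tfrac14+\tfrac{\mu}{x}+\tfrac{1/4-\nu^{2}}{x^{2}}\right)u=0$ with $u(x)\sim x^{\mu}e^{-x/2}$ as $x\to\infty$, and let $K_{\nu}(x)=\int_{0}^{\infty}e^{-x\cosh u}\cosh(\nu u)\,du$ be the modified Bessel function of the second kind. Then for all $x,\alpha>0$, both series below being absolutely convergent, $$W_{-\frac14,0}(x)\,W_{\frac14,0}(x)+2\sum_{n=1}^{\infty}W_{-\frac14,i\alpha n}(x)\,W_{\frac14,i\alpha n}(x)=\frac{x}{\sqrt{2}\,\alpha}\left\{e^{-\frac{x}{2}}K_{0}\left(\frac{x}{2}\right)+2\sum_{n=1}^{\infty}e^{-\frac{x}{2}\cosh\left(\frac{\pi n}{\alpha}\right)}K_{0}\left(\frac{x}{2}\cosh\left(\frac{\pi n}{\alpha}\right)\right)\right\}.$$ Moreover, for every $x>0$ one has the pair of Fourier transforms, with absolutely convergent integrals: for every $\xi\in\mathbb{R}$, $$\int_{-\infty}^{\infty}W_{-\frac14,i\tau}(x)\,W_{\frac14,i\tau}(x)\,e^{-i\tau\xi}\,d\tau=\frac{x}{\sqrt{2}}\,e^{-\frac{x}{2}\cosh\left(\frac{\xi}{2}\right)}K_{0}\left(\frac{x}{2}\cosh\left(\frac{\xi}{2}\right)\right),$$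 and for every $\tau\in\mathbb{R}$, $$W_{-\frac14,i\tau}(x)\,W_{\frac14,i\tau}(x)=\frac{x}{2\sqrt{2}\,\pi}\int_{-\infty}^{\infty}e^{-\frac{x}{2}\cosh\left(\frac{\xi}{2}\right)}K_{0}\left(\frac{x}{2}\cosh\left(\frac{\xi}{2}\right)\right)e^{i\tau\xi}\,d\xi.$$ -/

import Mathlib

open Filter Asymptotics

/-- `u` is, on `(0, ∞)`, the Whittaker function of indices `μ ∈ ℝ` and `ν ∈ ℂ`: it solves Whittaker's
equation `u'' + (-1/4 + μ / x + (1/4 - ν ^ 2) / x ^ 2) u = 0` there, and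
`u x ∼ x ^ μ * exp (-x / 2)` as `x → ∞`. The function `v` is the derivative of `u`. -/
def IsWhittakerW (μ : ℝ) (ν : ℂ) (u : ℝ → ℂ) : Prop :=
  (∃ v : ℝ → ℂ, ∀ x : ℝ, 0 < x →
    HasDerivAt u (v x) x ∧
    HasDerivAt v
      (-((-(1 / 4 : ℂ) + (μ : ℂ) / (x : ℂ) + (1 / 4 - ν ^ 2) / (x : ℂ) ^ 2) * u x)) x) ∧
  u ~[atTop] fun x : ℝ => ((x ^ μ * Real.exp (-x / 2) : ℝ) : ℂ)

/-- The two conditions of `IsWhittakerW` determine `u` on `(0, ∞)`. -/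
theorem IsWhittakerW.unique {μ : ℝ} {ν : ℂ} {u₁ u₂ : ℝ → ℂ} (h₁ : IsWhittakerW μ ν u₁)
    (h₂ : IsWhittakerW μ ν u₂) {x : ℝ} (hx : 0 < x) : u₁ x = u₂ x := by
  obtain ⟨⟨v₁, hv₁⟩, a₁⟩ := h₁
  obtain ⟨⟨v₂, hv₂⟩, a₂⟩ := h₂
  set Q : ℝ → ℂ := fun x =>
    -(1 / 4 : ℂ) + (μ : ℂ) / (x : ℂ) + (1 / 4 - ν ^ 2) / (x : ℂ) ^ 2 with hQ
  set g : ℝ → ℝ := fun x => x ^ μ * Real.exp (-x / 2) with hg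
  have hgpos : ∀ᶠ t in atTop, 0 < g t := by
    filter_upwards [eventually_gt_atTop 0] with t ht
    positivity
  have hg0 : ∀ᶠ t in atTop, ((g t : ℝ) : ℂ) ≠ 0 := by
    filter_upwards [hgpos] with t ht
    exact_mod_cast ht.ne'
  have l₁ : Tendsto (fun t => u₁ t / (g t : ℂ)) atTop (nhds 1) :=
    (isEquivalent_iff_tendsto_one hg0).1 a₁
  have l₂ : Tendsto (fun t => u₂ t / (g t : ℂ)) atTop (nhds 1) :=
    (isEquivalent_iff_tendsto_one hg0).1 a₂
  have lq : Tendsto (fun t => u₂ t / u₁ t) atTop (nhds 1) := by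
    have := l₂.div l₁ one_ne_zero
    rw [div_one] at this
    refine this.congr' ?_
    filter_upwards [hg0] with t ht
    simp only [Pi.div_apply]
    rw [div_div_div_cancel_right₀ ht]
  -- the inverse square of `u₁` has large real part
  have ginv : Tendsto (fun t => ((g t) ^ 2)⁻¹) atTop atTop := by
    have h := (tendsto_exp_mul_div_rpow_atTop (2 * μ) 1 one_pos)
    refine h.congr' ?_
    filter_upwards [eventually_gt_atTop 0] with t ht
    have e1 : t ^ (2 * μ) = (t ^ μ) ^ 2 := by
      rw [mul_comm, Real.rpow_mul ht.le]; norm_cast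
    have e2 : Real.exp (-t / 2) ^ 2 = (Real.exp (1 * t))⁻¹ := by
      rw [← Real.exp_nat_mul, ← Real.exp_neg]; congr 1; push_cast; ring
    simp only [hg, mul_pow, e1, e2, mul_inv, inv_inv]
    rw [div_eq_mul_inv, mul_comm]
  have lre : Tendsto (fun t => (((u₁ t / (g t : ℂ)) ^ 2)⁻¹).re) atTop (nhds 1) := by
    have h := (l₁.pow 2).inv₀ (by norm_num)
    have h' := (Complex.continuous_re.tendsto _).comp h
    rw [one_pow, inv_one, Complex.one_re] at h'
    exact h'
  have hre : ∀ᶠ t in atTop, 1 ≤ (((u₁ t) ^ 2)⁻¹).re := by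
    filter_upwards [lre.eventually (lt_mem_nhds (show (1 / 2 : ℝ) < 1 by norm_num)),
      ginv.eventually_ge_atTop 2, hg0] with t h1 h2 h3
    have e : ((u₁ t) ^ 2)⁻¹ = ((((g t) ^ 2)⁻¹ : ℝ) : ℂ) * ((u₁ t / (g t : ℂ)) ^ 2)⁻¹ := by
      push_cast
      rw [div_pow, inv_div, ← mul_div_assoc, inv_mul_cancel₀ (pow_ne_zero 2 h3), one_div]
    rw [e, Complex.re_ofReal_mul]
    nlinarith
  have hu0 : ∀ᶠ t in atTop, u₁ t ≠ 0 := by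
    filter_upwards [hre] with t ht h0
    rw [h0] at ht
    norm_num at ht
  obtain ⟨A, hA⟩ := eventually_atTop.1 (hre.and (hu0.and (eventually_gt_atTop 0)))
  -- the Wronskian is constant
  set w : ℝ → ℂ := fun t => u₁ t * v₂ t - u₂ t * v₁ t with hw
  have hwd : ∀ t, 0 < t → HasDerivAt w 0 t := by
    intro t ht
    have := ((hv₁ t ht).1.mul (hv₂ t ht).2).sub ((hv₂ t ht).1.mul (hv₁ t ht).2)
    refine this.congr_deriv ?_
    ring
  have hwc : ∀ t, A ≤ t → w t = w A := by
    intro t ht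
    exact constant_of_has_deriv_right_zero
      (fun s hs => (hwd s (hA s hs.1).2.2).continuousAt.continuousWithinAt)
      (fun s hs => (hwd s (hA s hs.1).2.2).hasDerivWithinAt) t ⟨ht, le_rfl⟩
  have hqd : ∀ t, A ≤ t → HasDerivAt (fun t => u₂ t / u₁ t) (w A * ((u₁ t) ^ 2)⁻¹) t := by
    intro t ht
    have h := (hv₂ t (hA t ht).2.2).1.div (hv₁ t (hA t ht).2.2).1 (hA t ht).2.1
    refine h.congr_deriv ?_
    rw [← hwc t ht, hw, div_eq_mul_inv]
    ring
  have hc : w A = 0 := by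
    by_contra hc
    have hd : ∀ t, A ≤ t →
        HasDerivAt (fun t => ((w A)⁻¹ * (u₂ t / u₁ t)).re) (((u₁ t) ^ 2)⁻¹).re t := by
      intro t ht
      have h := (hqd t ht).const_mul (w A)⁻¹
      rw [← mul_assoc, inv_mul_cancel₀ hc, one_mul] at h
      exact Complex.reCLM.hasFDerivAt.comp_hasDerivAt t h
    have hlin : ∀ t, A ≤ t →
        ((w A)⁻¹ * (u₂ A / u₁ A)).re + (t - A) ≤ ((w A)⁻¹ * (u₂ t / u₁ t)).re := by
      intro t ht
      have h := (convex_Ici A).mul_sub_le_image_sub_of_le_deriv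
        (f := fun t => ((w A)⁻¹ * (u₂ t / u₁ t)).re) (C := 1)
        (fun s hs => (hd s hs).continuousAt.continuousWithinAt)
        (fun s hs => (hd s (interior_subset hs)).differentiableAt.differentiableWithinAt)
        (fun s hs => by
          rw [(hd s (interior_subset hs)).deriv]
          exact (hA s (interior_subset hs)).1) A Set.self_mem_Ici t ht ht
      linarith
    have hlim : Tendsto (fun t => ((w A)⁻¹ * (u₂ t / u₁ t)).re) atTop
        (nhds ((w A)⁻¹ * 1).re) :=
      (Complex.continuous_re.tendsto _).comp (lq.const_mul _)
    refine not_tendsto_nhds_of_tendsto_atTop ?_ _ hlim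
    refine tendsto_atTop_mono' atTop (f₁ := fun t => ((w A)⁻¹ * (u₂ A / u₁ A)).re + (t - A)) ?_ ?_
    · filter_upwards [eventually_ge_atTop A] with t ht using hlin t ht
    · exact tendsto_atTop_add_const_left _ _ (tendsto_atTop_add_const_right _ (-A) tendsto_id)
  have hqc : ∀ t, A ≤ t → u₂ t / u₁ t = u₂ A / u₁ A := by
    intro t ht
    have hz : ∀ s, A ≤ s → HasDerivAt (fun t => u₂ t / u₁ t) 0 s := by
      intro s hs
      have := hqd s hs
      rwa [hc, zero_mul] at this
    exact constant_of_has_deriv_right_zero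
      (fun s hs => (hz s hs.1).continuousAt.continuousWithinAt)
      (fun s hs => (hz s hs.1).hasDerivWithinAt) t ⟨ht, le_rfl⟩
  have hq1 : ∀ t, A ≤ t → u₁ t = u₂ t := by
    have hone : u₂ A / u₁ A = 1 := by
      refine tendsto_nhds_unique (Tendsto.congr' ?_ tendsto_const_nhds) lq
      filter_upwards [eventually_ge_atTop A] with t ht using (hqc t ht).symm
    intro t ht
    have := hqc t ht
    rw [hone, div_eq_one_iff_eq (hA t ht).2.1] at this
    exact this.symm
  rcases le_or_gt A x with hAx | hxA
  · exact hq1 x hAx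
  -- continue the equality down to `x` by uniqueness for the initial value problem
  have hB : 0 < A + 1 := by linarith
  have hvB : v₁ (A + 1) = v₂ (A + 1) := by
    refine (hv₁ _ hB).1.unique ((hv₂ _ hB).1.congr_of_eventuallyEq ?_)
    filter_upwards [eventually_ge_nhds (show A < A + 1 by linarith)] with t ht using hq1 t ht
  have hQc : ContinuousOn Q (Set.Icc x (A + 1)) := by
    have hne : ∀ t ∈ Set.Icc x (A + 1), (t : ℂ) ≠ 0 := fun t ht => by
      exact_mod_cast (hx.trans_le ht.1).ne'
    have hof : ContinuousOn (fun t : ℝ => (t : ℂ)) (Set.Icc x (A + 1)) :=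
      Complex.continuous_ofReal.continuousOn
    exact (continuousOn_const.add (continuousOn_const.div hof hne)).add
      (continuousOn_const.div (hof.pow 2) fun t ht => pow_ne_zero 2 (hne t ht))
  obtain ⟨C, hC⟩ := isCompact_Icc.exists_bound_of_continuousOn hQc
  have key := ODE_solution_unique_of_mem_Icc_left (a := x) (b := A + 1)
    (K := Real.toNNReal (max 1 C))
    (v := fun t (p : ℂ × ℂ) => (p.2, -(Q t * p.1))) (s := fun _ => Set.univ)
    (f := fun t => (u₁ t, v₁ t)) (g := fun t => (u₂ t, v₂ t))
    (fun t ht => by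
      refine LipschitzOnWith.of_dist_le_mul fun p _ q _ => ?_
      rw [Real.coe_toNNReal _ (le_trans zero_le_one (le_max_left _ _)), Prod.dist_eq]
      refine max_le ?_ ?_
      · calc dist p.2 q.2 ≤ dist p q := le_max_right _ _
          _ = 1 * dist p q := (one_mul _).symm
          _ ≤ max 1 C * dist p q := by gcongr; exact le_max_left _ _
      · calc dist (-(Q t * p.1)) (-(Q t * q.1)) = ‖Q t‖ * dist p.1 q.1 := by
              rw [dist_neg_neg, dist_eq_norm, dist_eq_norm, ← mul_sub, norm_mul]
          _ ≤ max 1 C * dist p q := by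
              gcongr
              · exact (hC t ⟨ht.1.le, ht.2⟩).trans (le_max_right _ _)
              · exact le_max_left _ _)
    (fun t ht => ((hv₁ t (hx.trans_le ht.1)).1.prodMk
      (hv₁ t (hx.trans_le ht.1)).2).continuousAt.continuousWithinAt)
    (fun t ht => ((hv₁ t (hx.trans ht.1)).1.prodMk (hv₁ t (hx.trans ht.1)).2).hasDerivWithinAt)
    (fun _ _ => trivial)
    (fun t ht => ((hv₂ t (hx.trans_le ht.1)).1.prodMk
      (hv₂ t (hx.trans_le ht.1)).2).continuousAt.continuousWithinAt)
    (fun t ht => ((hv₂ t (hx.trans ht.1)).1.prodMk (hv₂ t (hx.trans ht.1)).2).hasDerivWithinAt)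
    (fun _ _ => trivial)
    (by
      rw [hq1 (A + 1) (by linarith), hvB])
  exact congrArg Prod.fst (key ⟨le_rfl, by linarith⟩)

open Classical in
/-- The Whittaker function `W_{μ,ν}(x)` for `x > 0`, with `μ` real and `ν` complex: the solution of
Whittaker's equation singled out by `W_{μ,ν}(x) ∼ x ^ μ * exp (-x / 2)` as `x → ∞`.
(It exists for all `μ`, `ν`; the value `0` below is only a formal default. By
`IsWhittakerW.eq_whittakerW` there is only one such solution on `(0, ∞)`.) -/
noncomputable def whittakerW (μ : ℝ) (ν : ℂ) (x : ℝ) : ℂ :=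
  if h : ∃ u : ℝ → ℂ, IsWhittakerW μ ν u then h.choose x else 0

theorem IsWhittakerW.eq_whittakerW {μ : ℝ} {ν : ℂ} {u : ℝ → ℂ} (h : IsWhittakerW μ ν u)
    {x : ℝ} (hx : 0 < x) : whittakerW μ ν x = u x := by
  have hex : ∃ u : ℝ → ℂ, IsWhittakerW μ ν u := ⟨u, h⟩
  rw [whittakerW, dif_pos hex]
  exact hex.choose_spec.unique h hx

/-- The modified Bessel function of the second kind (Macdonald function) `K_ν(x)`, `x > 0`, `ν ∈ ℂ`:
`K_ν(x) = ∫_0^∞ exp (-x cosh u) cosh (ν u) du`. -/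
noncomputable def besselK (ν : ℂ) (x : ℝ) : ℂ :=
  ∫ u : ℝ in Set.Ioi 0, (Real.exp (-x * Real.cosh u) : ℂ) * Complex.cosh (ν * (u : ℂ))

/-! Everything rests on one product formula, `whittakerW_mul_whittakerW`: with h = cosh t · cosh² v,
the product W_{-1/4,iτ}(x) W_{1/4,iτ}(x) equals x/(√2 π) times J_τ(x) = ∫∫ exp(2iτt - xh) dt dv
(`coshIntegral τ 0 x`). Integrating out v turns J_τ into half the Fourier integral of exp(-y) K_0(y)
with y = (x/2) cosh(ξ/2), ξ = 2t (`besselKernel_eq`, `integral_besselKernel_mul_exp`). The transform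
pair is then Fourier inversion, and the series identity is Poisson summation
(`poisson_besselKernel`); both run on the O(τ⁻²) bound of `coshIntegral_decay` and the Gaussian
decay of the kernel.

The product formula is proved by differential equations. If u'' = q₁u and w'' = q₂w, then uw, u'w,
uw', u'w' satisfy a linear first-order system. Two integrations by parts yield a recurrence
(`coshIntegral_recurrence`) showing that x·J_τ is the first component of a solution of that system
(`isTensorSolution_coshIntegral`). This solution is O(exp(-3x/4)). Its Wronskian-type contraction
with u solves the equation of w but is negligible against w at infinity, so uniqueness of the
Whittaker function forces it to vanish (`IsTensorSolution.contraction`). Hence the solution is a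
multiple of the product (`IsTensorSolution.eq_mul`), and Laplace's method (`tendsto_coshIntegral`)
fixes the constant. Existence of the two Whittaker functions, with bounded derivatives, comes from
the Tricomi integral (`exists_isWhittakerW`). -/

/-! ### Differentiation and decay of Laplace-type integrals. -/

section Laplace

open MeasureTheory Set Topology

variable {α : Type*} [MeasurableSpace α] {m : Measure α} {h : α → ℝ} {g : α → ℂ}

/-- The Laplace-type integrals `∫ g * exp (-ε h)` converge absolutely for all `ε > 0`. -/
def LaplaceIntegrable (m : Measure α) (h : α → ℝ) (g : α → ℂ) : Prop :=
  ∀ ε : ℝ, 0 < ε → Integrable (fun a => g a * (Real.exp (-(ε * h a)) : ℂ)) m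

/-- The Laplace-type integral `∫ g * exp (-x h)`. -/
noncomputable def laplaceIntegral (m : Measure α) (h : α → ℝ) (g : α → ℂ) (x : ℝ) : ℂ :=
  ∫ a, g a * (Real.exp (-(x * h a)) : ℂ) ∂m

/-- Half of the exponential absorbs the new factor, since h · exp(-εh/2) ≤ 2/ε; the other half keeps
the integral convergent. This makes the class stable under differentiation in x. -/
theorem LaplaceIntegrable.smul_exponent (hh : Measurable h) (h0 : ∀ᵐ a ∂m, 0 ≤ h a)
    (hg : LaplaceIntegrable m h g) : LaplaceIntegrable m h (fun a => (h a : ℂ) * g a) := by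
  intro ε hε
  refine Integrable.mono' ((hg (ε / 2) (half_pos hε)).norm.const_mul (2 / ε)) ?_ ?_
  · have := (Complex.measurable_ofReal.comp hh).aestronglyMeasurable.mul (hg ε hε).1
    refine this.congr (Eventually.of_forall fun a => ?_)
    simp [mul_assoc]
  · filter_upwards [h0] with a ha
    have e : Real.exp (-(ε * h a)) = Real.exp (-(ε / 2 * h a)) * Real.exp (-(ε / 2 * h a)) := by
      rw [← Real.exp_add]; ring_nf
    have k : h a * Real.exp (-(ε / 2 * h a)) ≤ 2 / ε := by
      have h1 := Real.add_one_le_exp (ε / 2 * h a)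
      rw [Real.exp_neg, ← div_eq_mul_inv, div_le_div_iff₀ (Real.exp_pos _) hε]
      linarith
    simp only [norm_mul, Complex.norm_real, Real.norm_eq_abs, abs_of_nonneg ha, Real.abs_exp]
    rw [e]
    calc h a * ‖g a‖ * (Real.exp (-(ε / 2 * h a)) * Real.exp (-(ε / 2 * h a)))
        = (h a * Real.exp (-(ε / 2 * h a))) * (‖g a‖ * Real.exp (-(ε / 2 * h a))) := by ring
      _ ≤ _ := by gcongr

/-- For y > x/2 the differentiated integrand is dominated by its own modulus at x/2. -/
theorem LaplaceIntegrable.hasDerivAt (hh : Measurable h) (h0 : ∀ᵐ a ∂m, 0 ≤ h a)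
    (hg : LaplaceIntegrable m h g) {x : ℝ} (hx : 0 < x) :
    HasDerivAt (laplaceIntegral m h g) (-laplaceIntegral m h (fun a => (h a : ℂ) * g a) x) x := by
  have hg' := hg.smul_exponent hh h0
  have key := hasDerivAt_integral_of_dominated_loc_of_deriv_le (μ := m) (𝕜 := ℝ) (x₀ := x)
    (F := fun x a => g a * (Real.exp (-(x * h a)) : ℂ))
    (F' := fun x a => -((h a : ℂ) * g a * (Real.exp (-(x * h a)) : ℂ)))
    (bound := fun a => ‖(h a : ℂ) * g a * (Real.exp (-(x / 2 * h a)) : ℂ)‖)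
    (s := Ioi (x / 2)) (Ioi_mem_nhds (by linarith))
    (by
      filter_upwards [Ioi_mem_nhds hx] with y hy using (hg y hy).1)
    (hg x hx) (hg' x hx).1.neg
    (by
      filter_upwards [h0] with a ha y hy
      have hy' : x / 2 < y := hy
      simp only [norm_neg, norm_mul, Complex.norm_real, Real.norm_eq_abs, Real.abs_exp]
      gcongr)
    (hg' (x / 2) (half_pos hx)).norm
    (by
      refine Eventually.of_forall fun a y _ => ?_
      have h1 : HasDerivAt (fun y : ℝ => Real.exp (-(y * h a)))
          (Real.exp (-(y * h a)) * (-(1 * h a))) y :=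
        (((hasDerivAt_id y).mul_const (h a)).neg).exp
      have h2 := (h1.ofReal_comp).const_mul (g a)
      refine h2.congr_deriv ?_
      push_cast
      ring)
  have := key.2
  rw [integral_neg] at this
  exact this

/-- When h ≥ 1 and x ≥ 1, exp(-xh) ≤ exp(-h) · exp(1 - x), so the whole decay factors out of the
integral. -/
theorem LaplaceIntegrable.norm_le (hg : LaplaceIntegrable m h g) (h1 : ∀ᵐ a ∂m, 1 ≤ h a) :
    ∃ C, ∀ x, 1 ≤ x → ‖laplaceIntegral m h g x‖ ≤ C * Real.exp (-x) := by
  refine ⟨(∫ a, ‖g a * (Real.exp (-(1 * h a)) : ℂ)‖ ∂m) * Real.exp 1, fun x hx => ?_⟩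
  rw [mul_assoc, ← Real.exp_add, ← integral_mul_const]
  refine norm_integral_le_of_norm_le ((hg 1 one_pos).norm.mul_const _) ?_
  filter_upwards [h1] with a ha
  simp only [norm_mul, Complex.norm_real, Real.norm_eq_abs, Real.abs_exp]
  rw [mul_assoc, ← Real.exp_add]
  gcongr
  nlinarith

theorem LaplaceIntegrable.norm_le_const (hg : LaplaceIntegrable m h g) (h0 : ∀ᵐ a ∂m, 0 ≤ h a) :
    ∃ C, ∀ x, 1 ≤ x → ‖laplaceIntegral m h g x‖ ≤ C := by
  refine ⟨∫ a, ‖g a * (Real.exp (-(1 * h a)) : ℂ)‖ ∂m, fun x hx => ?_⟩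
  refine norm_integral_le_of_norm_le (hg 1 one_pos).norm ?_
  filter_upwards [h0] with a ha
  simp only [norm_mul, Complex.norm_real, Real.norm_eq_abs, Real.abs_exp]
  gcongr

end Laplace

/-! ### Existence of the Whittaker function through the Tricomi integral. -/

section Whittaker

open MeasureTheory Set Topology

/-- The weight `t ^ p * (1 + t) ^ q` of the Laplace integral for the Tricomi function. -/
noncomputable def tricomiWeight (p q : ℂ) (t : ℝ) : ℂ := (t : ℂ) ^ p * ((1 + t : ℝ) : ℂ) ^ q

theorem norm_one_add_cpow_le_one {q : ℂ} (hq : q.re ≤ 0) {t : ℝ} (ht : 0 ≤ t) :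
    ‖((1 + t : ℝ) : ℂ) ^ q‖ ≤ 1 := by
  rw [Complex.norm_cpow_eq_rpow_re_of_pos (by linarith)]
  exact Real.rpow_le_one_of_one_le_of_nonpos (by linarith) hq

/-- Used with s = 0 and s = 1 for the two factors of `tricomiWeight`; this explains the expressions
`0 + t` further on. -/
theorem hasDerivAt_ofReal_cpow_shift {s : ℝ} (r : ℂ) {t : ℝ} (ht : 0 < s + t) :
    HasDerivAt (fun t : ℝ => ((s + t : ℝ) : ℂ) ^ r) (r * ((s + t : ℝ) : ℂ) ^ (r - 1)) t := by
  have h1 : HasDerivAt (fun t : ℝ => ((s + t : ℝ) : ℂ)) 1 t := by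
    simpa using ((hasDerivAt_id t).const_add s).ofReal_comp
  have h2 := (hasDerivAt_id ((s + t : ℝ) : ℂ)).cpow_const (c := r)
    (Complex.ofReal_mem_slitPlane.2 ht)
  have := h2.comp t h1
  simp only [id, mul_one] at this
  exact this

theorem tricomiWeight_continuousOn (p q : ℂ) : ContinuousOn (tricomiWeight p q) (Ioi 0) := by
  intro t ht
  have ht' : (0 : ℝ) < t := ht
  have h1 := (hasDerivAt_ofReal_cpow_shift (s := 0) p (t := t) (by linarith)).continuousAt
  have h2 := (hasDerivAt_ofReal_cpow_shift (s := 1) q (t := t) (by linarith)).continuousAt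
  have := h1.mul h2
  simp only [zero_add] at this
  exact this.continuousWithinAt

theorem laplaceIntegrable_tricomiWeight {p q : ℂ} (hp : -1 < p.re) (hq : q.re ≤ 0) :
    LaplaceIntegrable (volume.restrict (Ioi 0)) id (tricomiWeight p q) := by
  intro ε hε
  refine Integrable.mono' (integrableOn_rpow_mul_exp_neg_mul_rpow hp one_pos hε) ?_ ?_
  · refine ContinuousOn.aestronglyMeasurable ?_ measurableSet_Ioi
    refine (tricomiWeight_continuousOn p q).mul (Continuous.continuousOn ?_)
    fun_prop
  · filter_upwards [ae_restrict_mem measurableSet_Ioi] with t ht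
    have ht' : (0 : ℝ) < t := ht
    rw [tricomiWeight, norm_mul, norm_mul, Complex.norm_cpow_eq_rpow_re_of_pos ht',
      Complex.norm_real, Real.norm_eq_abs, Real.abs_exp, Real.rpow_one, id, neg_mul]
    have := norm_one_add_cpow_le_one hq ht'.le
    gcongr
    exact mul_le_of_le_one_right (by positivity) this

theorem ae_nonneg_restrict_Ioi : ∀ᵐ t ∂(volume.restrict (Ioi (0 : ℝ))), (0 : ℝ) ≤ id t := by
  filter_upwards [ae_restrict_mem measurableSet_Ioi] with t ht using (le_of_lt ht)

/-- The Laplace integral for the Tricomi function and its first two derivatives up to sign. -/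
noncomputable def tricomiIntegral (p q : ℂ) (n : ℕ) (x : ℝ) : ℂ :=
  laplaceIntegral (volume.restrict (Ioi 0)) id (fun t => (t : ℂ) ^ n * tricomiWeight p q t) x

theorem laplaceIntegrable_pow_mul_tricomiWeight {p q : ℂ} (hp : -1 < p.re) (hq : q.re ≤ 0)
    (n : ℕ) : LaplaceIntegrable (volume.restrict (Ioi 0)) id
      (fun t => (t : ℂ) ^ n * tricomiWeight p q t) := by
  induction n with
  | zero => simpa using laplaceIntegrable_tricomiWeight hp hq
  | succ n ih =>
    have := ih.smul_exponent measurable_id ae_nonneg_restrict_Ioi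
    simpa only [pow_succ', mul_assoc, id] using this

theorem tricomiIntegral_hasDerivAt {p q : ℂ} (hp : -1 < p.re) (hq : q.re ≤ 0) (n : ℕ)
    {x : ℝ} (hx : 0 < x) :
    HasDerivAt (tricomiIntegral p q n) (-tricomiIntegral p q (n + 1) x) x := by
  have := (laplaceIntegrable_pow_mul_tricomiWeight hp hq n).hasDerivAt measurable_id
    ae_nonneg_restrict_Ioi hx
  refine HasDerivAt.congr_deriv this ?_
  simp only [tricomiIntegral, pow_succ', mul_assoc, id]

/-- This is Kummer's equation: the combination integrates the total derivative of t^(p+1)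
(1+t)^(q+1) exp(-xt), whose boundary term at 0 vanishes because Re p > -1. -/
theorem tricomiIntegral_recurrence {p q : ℂ} (hp : -1 < p.re) (hq : q.re ≤ 0)
    {x : ℝ} (hx : 0 < x) :
    -x * (tricomiIntegral p q 2 x + tricomiIntegral p q 1 x) + (p + 1) * tricomiIntegral p q 0 x
      + (p + q + 2) * tricomiIntegral p q 1 x = 0 := by
  set I : ℕ → ℝ → ℂ := fun n t =>
    (t : ℂ) ^ n * tricomiWeight p q t * (Real.exp (-(x * id t)) : ℂ) with hI
  have hint : ∀ n, IntegrableOn (I n) (Ioi 0) := fun n =>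
    laplaceIntegrable_pow_mul_tricomiWeight hp hq n x hx
  set f : ℝ → ℂ := fun t =>
    ((0 + t : ℝ) : ℂ) ^ (p + 1) * ((1 + t : ℝ) : ℂ) ^ (q + 1) * (Real.exp (-(x * t)) : ℂ) with hf
  set f' : ℝ → ℂ := fun t => -x * (I 2 t + I 1 t) + (p + 1) * I 0 t + (p + q + 2) * I 1 t with hf'
  have hpow : ∀ {s : ℝ} (r : ℂ), 0 < s → (s : ℂ) ^ (r + 1) = (s : ℂ) ^ r * s := by
    intro s r hs
    rw [Complex.cpow_add _ _ (by exact_mod_cast hs.ne'), Complex.cpow_one]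
  have hf'int : IntegrableOn f' (Ioi 0) :=
    ((((hint 2).add (hint 1)).const_mul _).add ((hint 0).const_mul _)).add ((hint 1).const_mul _)
  have hfint : IntegrableOn f (Ioi 0) := by
    refine ((hint 1).add (hint 2)).congr_fun (fun t ht => ?_) measurableSet_Ioi
    have ht' : (0 : ℝ) < t := ht
    simp only [hI, hf, tricomiWeight, Pi.add_apply, id, zero_add]
    rw [hpow p ht', hpow q (show (0 : ℝ) < 1 + t by linarith)]
    push_cast
    ring
  have hderiv : ∀ t ∈ Ioi (0 : ℝ), HasDerivAt f (f' t) t := by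
    intro t ht
    have ht' : (0 : ℝ) < t := ht
    have h1 := hasDerivAt_ofReal_cpow_shift (s := 0) (p + 1) (t := t) (by linarith)
    have h2 := hasDerivAt_ofReal_cpow_shift (s := 1) (q + 1) (t := t) (by linarith)
    have h3 : HasDerivAt (fun t : ℝ => Real.exp (-(x * t)))
        (Real.exp (-(x * t)) * (-(x * 1))) t := (((hasDerivAt_id t).const_mul x).neg).exp
    refine ((h1.mul h2).mul h3.ofReal_comp).congr_deriv ?_
    simp only [hf', hI, tricomiWeight, id, zero_add, add_sub_cancel_right, Pi.mul_apply]
    rw [hpow p ht', hpow q (show (0 : ℝ) < 1 + t by linarith)]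
    push_cast
    ring
  have hcont : ContinuousWithinAt f (Ici 0) 0 := by
    have h1 : ContinuousAt (fun t : ℝ => ((0 + t : ℝ) : ℂ) ^ (p + 1)) 0 := by
      simp only [zero_add]
      exact Complex.continuousAt_ofReal_cpow_const 0 (p + 1) (Or.inl (by simp; linarith))
    have h2 := (hasDerivAt_ofReal_cpow_shift (s := 1) (q + 1) (t := 0) (by linarith)).continuousAt
    have h3 : ContinuousAt (fun t : ℝ => (Real.exp (-(x * t)) : ℂ)) 0 := by fun_prop
    exact ((h1.mul h2).mul h3).continuousWithinAt
  have hlim := tendsto_zero_of_hasDerivAt_of_integrableOn_Ioi hderiv hf'int hfint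
  have key := integral_Ioi_of_hasDerivAt_of_tendsto hcont hderiv hf'int hlim
  have hf0 : f 0 = 0 := by
    have : p + 1 ≠ 0 := fun h => by
      have := congrArg Complex.re h
      simp at this
      linarith
    simp [hf, Complex.zero_cpow this]
  rw [hf0, sub_zero] at key
  rw [← key]
  simp only [hf']
  rw [integral_add, integral_add, integral_const_mul, integral_const_mul, integral_const_mul,
    integral_add]
  · rfl
  · exact hint 2
  · exact hint 1
  · exact ((hint 2).add (hint 1)).const_mul _
  · exact (hint 0).const_mul _
  · exact (((hint 2).add (hint 1)).const_mul _).add ((hint 0).const_mul _)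
  · exact (hint 1).const_mul _

theorem tricomiIntegral_zero_rescale (p q : ℂ) {x : ℝ} (hx : 0 < x) :
    (x : ℂ) ^ (p + 1) * tricomiIntegral p q 0 x =
      ∫ s in Ioi (0 : ℝ), (s : ℂ) ^ p * ((1 + s / x : ℝ) : ℂ) ^ q * (Real.exp (-s) : ℂ) := by
  have h := integral_comp_mul_left_Ioi
    (fun s : ℝ => (s : ℂ) ^ p * ((1 + s / x : ℝ) : ℂ) ^ q * (Real.exp (-s) : ℂ)) 0 hx
  rw [mul_zero] at h
  have hx' : (x : ℂ) ≠ 0 := by exact_mod_cast hx.ne'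
  have h2 : ∫ s in Ioi (0 : ℝ), (s : ℂ) ^ p * ((1 + s / x : ℝ) : ℂ) ^ q * (Real.exp (-s) : ℂ) =
      (x : ℂ) * ∫ t in Ioi (0 : ℝ), ((x * t : ℝ) : ℂ) ^ p * ((1 + x * t / x : ℝ) : ℂ) ^ q *
        (Real.exp (-(x * t)) : ℂ) := by
    rw [h, Complex.real_smul, Complex.ofReal_inv, mul_inv_cancel_left₀ hx']
  rw [h2, tricomiIntegral, laplaceIntegral, ← integral_const_mul, ← integral_const_mul]
  refine setIntegral_congr_fun measurableSet_Ioi fun t ht => ?_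
  have ht' : (0 : ℝ) < t := ht
  simp only [tricomiWeight, id, pow_zero, one_mul]
  rw [mul_div_cancel_left₀ _ hx.ne', Complex.ofReal_mul, Complex.mul_cpow_ofReal_nonneg hx.le ht'.le,
    Complex.cpow_add _ _ hx', Complex.cpow_one]
  ring

/-- After the substitution s = xt, dominated convergence applies: Re q ≤ 0 gives |(1 + s/x)^q| ≤ 1,
and this factor tends to 1. -/
theorem tendsto_cpow_mul_tricomiIntegral {p q : ℂ} (hp : -1 < p.re) (hq : q.re ≤ 0) :
    Tendsto (fun x : ℝ => (x : ℂ) ^ (p + 1) * tricomiIntegral p q 0 x) atTop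
      (𝓝 (Complex.Gamma (p + 1))) := by
  have hG : Complex.Gamma (p + 1) = ∫ s in Ioi (0 : ℝ), (s : ℂ) ^ p * (Real.exp (-s) : ℂ) := by
    rw [Complex.Gamma_eq_integral (by simp; linarith), Complex.GammaIntegral]
    refine setIntegral_congr_fun measurableSet_Ioi fun t _ => ?_
    simp only [add_sub_cancel_right]
    rw [mul_comm]
  rw [hG]
  have key : Tendsto (fun x : ℝ => ∫ s in Ioi (0 : ℝ),
      (s : ℂ) ^ p * ((1 + s / x : ℝ) : ℂ) ^ q * (Real.exp (-s) : ℂ)) atTop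
      (𝓝 (∫ s in Ioi (0 : ℝ), (s : ℂ) ^ p * (Real.exp (-s) : ℂ))) := by
    refine tendsto_integral_filter_of_dominated_convergence
      (fun s => s ^ p.re * Real.exp (-1 * s ^ (1 : ℝ))) ?_ ?_
      (integrableOn_rpow_mul_exp_neg_mul_rpow hp one_pos one_pos) ?_
    · filter_upwards [eventually_gt_atTop 0] with x hx
      refine ContinuousOn.aestronglyMeasurable (fun t ht => ?_) measurableSet_Ioi
      have ht' : (0 : ℝ) < t := ht
      have h1 := (hasDerivAt_ofReal_cpow_shift (s := 0) p (t := t) (by linarith)).continuousAt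
      have h2 : ContinuousAt (fun s : ℝ => ((1 + s / x : ℝ) : ℂ) ^ q) t := by
        have := (hasDerivAt_ofReal_cpow_shift (s := 1) q (t := t / x) (by positivity)).continuousAt
        exact ContinuousAt.comp (f := fun s : ℝ => s / x) this (by fun_prop)
      simp only [zero_add] at h1
      exact ((h1.mul h2).mul (by fun_prop)).continuousWithinAt
    · filter_upwards [eventually_gt_atTop 0] with x hx
      filter_upwards [ae_restrict_mem measurableSet_Ioi] with t ht
      have ht' : (0 : ℝ) < t := ht
      rw [norm_mul, norm_mul, Complex.norm_cpow_eq_rpow_re_of_pos ht',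
        Complex.norm_real, Real.norm_eq_abs, Real.abs_exp, Real.rpow_one, neg_one_mul]
      have := norm_one_add_cpow_le_one hq (show 0 ≤ t / x by positivity)
      gcongr
      exact mul_le_of_le_one_right (by positivity) this
    · refine Eventually.of_forall fun s => ?_
      have h0 : Tendsto (fun x : ℝ => s / x) atTop (𝓝 0) := tendsto_const_nhds.div_atTop tendsto_id
      have h2 := (hasDerivAt_ofReal_cpow_shift (s := 1) q (t := 0) (by norm_num)).continuousAt
      have h3 := (h2.tendsto.comp h0).const_mul ((s : ℂ) ^ p)
      have h4 := h3.mul_const (Real.exp (-s) : ℂ)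
      simpa using h4
  refine key.congr' ?_
  filter_upwards [eventually_gt_atTop 0] with x hx using (tricomiIntegral_zero_rescale p q hx).symm

/-- If `Re (ν - κ) > -1/2` and `Re (ν + κ) ≤ 1/2`, the Whittaker function exists, and its
derivative is bounded near infinity. -/
theorem exists_isWhittakerW {κ : ℝ} {ν : ℂ} (h1 : -1 / 2 < (ν - κ).re) (h2 : (ν + κ).re ≤ 1 / 2) :
    ∃ u v : ℝ → ℂ, IsWhittakerW κ ν u ∧
      (∀ x : ℝ, 0 < x → HasDerivAt u (v x) x ∧ HasDerivAt v
        (-((-(1 / 4 : ℂ) + (κ : ℂ) / (x : ℂ) + (1 / 4 - ν ^ 2) / (x : ℂ) ^ 2) * u x)) x) ∧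
      v =O[atTop] fun _ => (1 : ℝ) := by
  -- The classical representation is used: u = Γ(p+1)⁻¹ exp(-x/2) x^k ∫ t^p (1+t)^q exp(-xt) dt over
  -- t > 0. The two hypotheses say exactly Re p > -1 and Re q ≤ 0.
  obtain ⟨p, hpdef⟩ : ∃ p : ℂ, p = ν - κ - 1 / 2 := ⟨_, rfl⟩
  obtain ⟨q, hqdef⟩ : ∃ q : ℂ, q = ν + κ - 1 / 2 := ⟨_, rfl⟩
  obtain ⟨k, hkdef⟩ : ∃ k : ℂ, k = ν + 1 / 2 := ⟨_, rfl⟩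
  have hhalf : ((1 / 2 : ℂ)).re = 1 / 2 := by norm_num
  have hp : -1 < p.re := by
    rw [hpdef, Complex.sub_re, hhalf]; linarith
  have hq : q.re ≤ 0 := by
    rw [hqdef, Complex.sub_re, hhalf]; linarith
  set F : ℕ → ℝ → ℂ := tricomiIntegral p q with hF
  set c : ℂ := (Complex.Gamma (p + 1))⁻¹ with hc
  have hΓ : Complex.Gamma (p + 1) ≠ 0 := Complex.Gamma_ne_zero_of_re_pos (by simp; linarith)
  set e : ℝ → ℂ := fun x => (Real.exp (-x / 2) : ℂ) * ((0 + x : ℝ) : ℂ) ^ k with he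
  have hed : ∀ x, 0 < x → HasDerivAt e (e x * (k / x - 1 / 2)) x := by
    intro x hx
    have hx' : (x : ℂ) ≠ 0 := by exact_mod_cast hx.ne'
    have h1 : HasDerivAt (fun x : ℝ => Real.exp (-x / 2)) (Real.exp (-x / 2) * (-1 / 2)) x :=
      (((hasDerivAt_id x).neg).div_const 2).exp
    refine (h1.ofReal_comp.mul
      (hasDerivAt_ofReal_cpow_shift (s := 0) k (t := x) (by linarith))).congr_deriv ?_
    simp only [he, zero_add]
    rw [Complex.cpow_sub _ _ hx', Complex.cpow_one]
    push_cast
    field_simp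
    ring
  set u : ℝ → ℂ := fun x => c * (e x * F 0 x) with hu
  set v : ℝ → ℂ := fun x => c * (e x * (-F 1 x + (k / x - 1 / 2) * F 0 x)) with hv
  have hinv : ∀ x : ℝ, 0 < x → HasDerivAt (fun x : ℝ => k / (x : ℂ) - 1 / 2) (-k / x ^ 2) x := by
    intro x hx
    have hx' : (x : ℂ) ≠ 0 := by exact_mod_cast hx.ne'
    have h1 : HasDerivAt (fun x : ℝ => (x : ℂ)) 1 x := by
      simpa using (hasDerivAt_id x).ofReal_comp
    refine (((hasDerivAt_const x k).div h1 hx').sub_const (1 / 2)).congr_deriv ?_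
    simp
  have hode : ∀ x : ℝ, 0 < x → HasDerivAt u (v x) x ∧ HasDerivAt v
        (-((-(1 / 4 : ℂ) + (κ : ℂ) / (x : ℂ) + (1 / 4 - ν ^ 2) / (x : ℂ) ^ 2) * u x)) x := by
    intro x hx
    have hx' : (x : ℂ) ≠ 0 := by exact_mod_cast hx.ne'
    have d0 := tricomiIntegral_hasDerivAt hp hq 0 hx
    have d1 := tricomiIntegral_hasDerivAt hp hq 1 hx
    have hrec := tricomiIntegral_recurrence hp hq hx
    constructor
    · refine (((hed x hx).mul d0).const_mul c).congr_deriv ?_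
      simp only [hv, hF]
      ring
    · refine (((hed x hx).mul (d1.neg.add ((hinv x hx).mul d0))).const_mul c).congr_deriv ?_
      simp only [hu, ← hF, zero_add, Nat.reduceAdd, Pi.neg_apply, Pi.add_apply, Pi.mul_apply] at hrec ⊢
      -- Kummer's equation eliminates the second derivative of the integral; what remains is
      -- algebra.
      have hrec' : F 2 x = (-x * F 1 x + (p + 1) * F 0 x + (p + q + 2) * F 1 x) / x := by
        field_simp
        linear_combination -hrec
      rw [hrec', hpdef, hqdef, hkdef]
      field_simp
      ring
  refine ⟨u, v, ⟨⟨v, hode⟩, ?_⟩, hode, ?_⟩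
  · have hne : ∀ᶠ x : ℝ in atTop, ((x ^ κ * Real.exp (-x / 2) : ℝ) : ℂ) ≠ 0 := by
      filter_upwards [eventually_gt_atTop 0] with x hx
      have : 0 < x ^ κ * Real.exp (-x / 2) := by positivity
      exact_mod_cast this.ne'
    rw [isEquivalent_iff_tendsto_one hne]
    have := (tendsto_cpow_mul_tricomiIntegral hp hq).const_mul c
    rw [hc, inv_mul_cancel₀ hΓ, ← hc] at this
    refine this.congr' ?_
    filter_upwards [eventually_gt_atTop 0, hne] with x hx hx0
    have hx' : (x : ℂ) ≠ 0 := by exact_mod_cast hx.ne'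
    rw [Pi.div_apply, eq_div_iff hx0]
    simp only [hu, he, zero_add, hF]
    -- Of x^k, the part x^(p+1) is consumed by the limit of the integral and x^κ is the required
    -- power.
    have : k = (p + 1) + κ := by rw [hkdef, hpdef]; ring
    rw [this, Complex.cpow_add (p + 1) κ hx', Complex.ofReal_mul, Complex.ofReal_cpow hx.le]
    ring
  · have hbd : ∀ n, F n =O[atTop] fun _ => (1 : ℝ) := by
      intro n
      obtain ⟨C, hC⟩ := (laplaceIntegrable_pow_mul_tricomiWeight hp hq n).norm_le_const
        ae_nonneg_restrict_Ioi
      refine IsBigO.of_bound C ?_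
      filter_upwards [eventually_ge_atTop 1] with x hx
      simpa [hF, tricomiIntegral] using hC x hx
    have hebd : e =O[atTop] fun _ => (1 : ℝ) := by
      have h0 : Tendsto (fun x : ℝ => x ^ k.re * Real.exp (-(1 / 2) * x)) atTop (𝓝 0) :=
        tendsto_rpow_mul_exp_neg_mul_atTop_nhds_zero _ _ (by norm_num)
      refine IsBigO.trans ?_ (h0.isBigO_one ℝ)
      refine IsBigO.of_bound 1 ?_
      filter_upwards [eventually_gt_atTop 0] with x hx
      simp only [he, zero_add, norm_mul, Complex.norm_real, Real.norm_eq_abs, Real.abs_exp, one_mul]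
      rw [Complex.norm_cpow_eq_rpow_re_of_pos hx, abs_of_nonneg (by positivity : 0 ≤ x ^ k.re),
        mul_comm]
      apply le_of_eq
      ring_nf
    have hkbd : (fun x : ℝ => k / (x : ℂ) - 1 / 2) =O[atTop] fun _ => (1 : ℝ) := by
      have h0 : Tendsto (fun x : ℝ => k / (x : ℂ)) atTop (𝓝 0) := by
        have := ((Complex.continuous_ofReal.tendsto 0).comp tendsto_inv_atTop_zero).const_mul k
        simpa [div_eq_mul_inv, Function.comp_def] using this
      exact (h0.sub_const (1 / 2)).isBigO_one ℝ
    have h1 : (fun x : ℝ => (k / (x : ℂ) - 1 / 2) * F 0 x) =O[atTop] fun _ => (1 : ℝ) :=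
      (hkbd.mul (hbd 0)).congr_right (by simp)
    exact ((hebd.mul ((hbd 1).neg_left.add h1)).congr_right (by simp)).const_mul_left c

end Whittaker

/-! ### The double integral with exponent cosh t · cosh² v, and integration by parts in it. -/

section Kernel

open MeasureTheory Set Topology

/-- The exponent `cosh t * cosh v ^ 2`. -/
noncomputable def coshExponent (z : ℝ × ℝ) : ℝ := Real.cosh z.1 * Real.cosh z.2 ^ 2

theorem one_add_sq_half_le_cosh (t : ℝ) : 1 + t ^ 2 / 2 ≤ Real.cosh t := by
  have h1 : Real.cosh t = 1 + 2 * Real.sinh (t / 2) ^ 2 := by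
    have := Real.cosh_two_mul (t / 2)
    rw [Real.cosh_sq, mul_div_cancel₀ t (two_ne_zero)] at this
    linarith
  have h2 : (t / 2) ^ 2 ≤ Real.sinh (t / 2) ^ 2 := by
    rcases le_total 0 (t / 2) with h | h
    · exact pow_le_pow_left₀ h (Real.self_le_sinh_iff.2 h) 2
    · have := Real.sinh_le_self_iff.2 h
      nlinarith
  rw [h1]
  nlinarith

/-- The bound is sharp to second order at the origin, so it serves both as a Gaussian majorant for
integrability and as the exact limiting Gaussian in Laplace's method. -/
theorem coshExponent_ge (z : ℝ × ℝ) : 1 + z.1 ^ 2 / 2 + z.2 ^ 2 ≤ coshExponent z := by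
  have h1 := one_add_sq_half_le_cosh z.1
  have h2 := one_add_sq_half_le_cosh z.2
  have h3 : 1 + z.2 ^ 2 ≤ Real.cosh z.2 ^ 2 := by nlinarith [sq_nonneg z.2]
  calc 1 + z.1 ^ 2 / 2 + z.2 ^ 2 ≤ (1 + z.1 ^ 2 / 2) * (1 + z.2 ^ 2) := by
        nlinarith [mul_nonneg (sq_nonneg z.1) (sq_nonneg z.2)]
    _ ≤ _ := by unfold coshExponent; gcongr

theorem one_le_coshExponent (z : ℝ × ℝ) : 1 ≤ coshExponent z := by
  have := coshExponent_ge z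
  nlinarith [sq_nonneg z.1, sq_nonneg z.2]

theorem coshExponent_pos (z : ℝ × ℝ) : 0 < coshExponent z :=
  one_pos.trans_le (one_le_coshExponent z)

theorem continuous_coshExponent : Continuous coshExponent := by
  unfold coshExponent
  fun_prop

/-- Continuous weights bounded by a power of `coshExponent`. -/
def CoshTempered (g : ℝ × ℝ → ℂ) : Prop :=
  Continuous g ∧ ∃ (K : ℝ) (n : ℕ), ∀ z, ‖g z‖ ≤ K * coshExponent z ^ n

namespace CoshTempered

variable {f g : ℝ × ℝ → ℂ}

theorem add (hf : CoshTempered f) (hg : CoshTempered g) : CoshTempered (fun z => f z + g z) := by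
  obtain ⟨cf, K, n, hK⟩ := hf
  obtain ⟨cg, L, k, hL⟩ := hg
  refine ⟨cf.add cg, |K| + |L|, n + k, fun z => (norm_add_le _ _).trans ?_⟩
  have h1 := one_le_coshExponent z
  have h2 : coshExponent z ^ n ≤ coshExponent z ^ (n + k) := pow_le_pow_right₀ h1 (by omega)
  have h3 : coshExponent z ^ k ≤ coshExponent z ^ (n + k) := pow_le_pow_right₀ h1 (by omega)
  have h4 := coshExponent_pos z
  rw [add_mul]
  refine add_le_add ((hK z).trans ?_) ((hL z).trans ?_)
  · exact mul_le_mul (le_abs_self K) h2 (by positivity) (by positivity)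
  · exact mul_le_mul (le_abs_self L) h3 (by positivity) (by positivity)

theorem mul (hf : CoshTempered f) (hg : CoshTempered g) : CoshTempered (fun z => f z * g z) := by
  obtain ⟨cf, K, n, hK⟩ := hf
  obtain ⟨cg, L, k, hL⟩ := hg
  refine ⟨cf.mul cg, K * L, n + k, fun z => ?_⟩
  have h4 := coshExponent_pos z
  rw [norm_mul, pow_add]
  calc ‖f z‖ * ‖g z‖ ≤ (K * coshExponent z ^ n) * (L * coshExponent z ^ k) :=
        mul_le_mul (hK z) (hL z) (norm_nonneg _) ((norm_nonneg _).trans (hK z))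
    _ = _ := by ring

theorem const (c : ℂ) : CoshTempered (fun _ => c) :=
  ⟨continuous_const, ‖c‖, 0, fun z => by simp⟩

theorem neg (hf : CoshTempered f) : CoshTempered (fun z => -f z) := by
  simpa using (const (-1)).mul hf

theorem sub (hf : CoshTempered f) (hg : CoshTempered g) : CoshTempered (fun z => f z - g z) := by
  simpa [sub_eq_add_neg] using hf.add hg.neg

theorem pow (hf : CoshTempered f) (n : ℕ) : CoshTempered (fun z => f z ^ n) := by
  induction n with
  | zero => simpa using const 1
  | succ n ih => simpa [pow_succ] using ih.mul hf

theorem of_abs_le {r : ℝ × ℝ → ℝ} (hr : Continuous r) (hb : ∀ z, |r z| ≤ coshExponent z) :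
    CoshTempered (fun z => (r z : ℂ)) :=
  ⟨Complex.continuous_ofReal.comp hr, 1, 1, fun z => by simpa using hb z⟩

/-- The weight 1 is dominated by a Gaussian; powers of the exponent follow by repeated use of
`LaplaceIntegrable.smul_exponent`. -/
theorem laplaceIntegrable (hg : CoshTempered g) :
    LaplaceIntegrable volume coshExponent g := by
  obtain ⟨cg, K, n, hK⟩ := hg
  have hone : LaplaceIntegrable volume coshExponent (fun _ => (1 : ℂ)) := by
    intro ε hε
    have h1 := (integrable_exp_neg_mul_sq (half_pos hε)).mul_prod (integrable_exp_neg_mul_sq hε)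
    refine Integrable.mono' h1 ?_ ?_
    · have := continuous_coshExponent
      exact Continuous.aestronglyMeasurable (by fun_prop)
    · refine Eventually.of_forall fun z => ?_
      rw [one_mul, Complex.norm_real, Real.norm_eq_abs, Real.abs_exp, ← Real.exp_add]
      gcongr
      have := coshExponent_ge z
      nlinarith
  have hpow : ∀ n : ℕ, LaplaceIntegrable volume coshExponent
      (fun z => (coshExponent z : ℂ) ^ n) := by
    intro n
    induction n with
    | zero => simpa using hone
    | succ n ih =>
      have := ih.smul_exponent continuous_coshExponent.measurable
        (Eventually.of_forall fun z => (coshExponent_pos z).le)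
      simpa only [pow_succ'] using this
  intro ε hε
  refine Integrable.mono' ((hpow n ε hε).norm.const_mul K) ?_ ?_
  · have := continuous_coshExponent
    exact (cg.mul (by fun_prop)).aestronglyMeasurable
  · refine Eventually.of_forall fun z => ?_
    rw [norm_mul, norm_mul, norm_pow, Complex.norm_real, Complex.norm_real, Real.norm_eq_abs,
      Real.norm_eq_abs, abs_of_pos (coshExponent_pos z), ← mul_assoc]
    gcongr
    exact hK z

end CoshTempered

/-- The oscillating factor `exp (2 i τ t)`. -/
noncomputable def oscFactor (τ : ℝ) (z : ℝ × ℝ) : ℂ := Complex.exp (2 * Complex.I * τ * z.1)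

theorem norm_oscFactor (τ : ℝ) (z : ℝ × ℝ) : ‖oscFactor τ z‖ = 1 := by
  have : 2 * Complex.I * τ * z.1 = ((2 * τ * z.1 : ℝ) : ℂ) * Complex.I := by push_cast; ring
  rw [oscFactor, this, Complex.norm_exp_ofReal_mul_I]

theorem continuous_oscFactor (τ : ℝ) : Continuous (oscFactor τ) := by
  unfold oscFactor
  fun_prop

theorem coshTempered_oscFactor (τ : ℝ) : CoshTempered (oscFactor τ) :=
  ⟨continuous_oscFactor τ, 1, 0, fun z => by simp [norm_oscFactor]⟩

theorem oscFactor_hasDerivAt (τ t v : ℝ) :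
    HasDerivAt (fun t => oscFactor τ (t, v)) (2 * Complex.I * τ * oscFactor τ (t, v)) t := by
  have h1 : HasDerivAt (fun t : ℝ => (t : ℂ)) 1 t := by
    simpa using (hasDerivAt_id t).ofReal_comp
  have := (h1.const_mul (2 * Complex.I * τ)).cexp
  refine this.congr_deriv ?_
  simp only [oscFactor]
  ring

theorem coshTempered_cosh_fst : CoshTempered (fun z => ((Real.cosh z.1 : ℝ) : ℂ)) := by
  refine .of_abs_le (by fun_prop) fun z => ?_
  have := Real.one_le_cosh z.2
  rw [abs_of_pos (Real.cosh_pos _)]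
  exact le_mul_of_one_le_right (Real.cosh_pos _).le (one_le_pow₀ this)

theorem coshTempered_cosh_snd : CoshTempered (fun z => ((Real.cosh z.2 : ℝ) : ℂ)) := by
  refine .of_abs_le (by fun_prop) fun z => ?_
  have := Real.one_le_cosh z.1
  have := Real.one_le_cosh z.2
  rw [abs_of_pos (Real.cosh_pos _)]
  unfold coshExponent
  nlinarith

theorem abs_sinh_le_cosh (t : ℝ) : |Real.sinh t| ≤ Real.cosh t := by
  rw [Real.abs_sinh]
  exact (Real.sinh_lt_cosh _).le.trans_eq (Real.cosh_abs t)

theorem coshTempered_sinh_fst : CoshTempered (fun z => ((Real.sinh z.1 : ℝ) : ℂ)) := by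
  obtain ⟨-, K, n, h⟩ := coshTempered_cosh_fst
  refine ⟨by fun_prop, K, n, fun z => le_trans ?_ (h z)⟩
  rw [Complex.norm_real, Complex.norm_real, Real.norm_eq_abs, Real.norm_eq_abs,
    abs_of_pos (Real.cosh_pos _)]
  exact abs_sinh_le_cosh z.1

theorem coshTempered_sinh_snd : CoshTempered (fun z => ((Real.sinh z.2 : ℝ) : ℂ)) := by
  obtain ⟨-, K, n, h⟩ := coshTempered_cosh_snd
  refine ⟨by fun_prop, K, n, fun z => le_trans ?_ (h z)⟩
  rw [Complex.norm_real, Complex.norm_real, Real.norm_eq_abs, Real.norm_eq_abs,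
    abs_of_pos (Real.cosh_pos _)]
  exact abs_sinh_le_cosh z.2

theorem ofReal_cosh_ne_zero (t : ℝ) : ((Real.cosh t : ℝ) : ℂ) ≠ 0 :=
  Complex.ofReal_ne_zero.2 (Real.cosh_pos t).ne'

theorem norm_inv_cosh_le_one (t : ℝ) : ‖(((Real.cosh t : ℝ) : ℂ))⁻¹‖ ≤ 1 := by
  rw [norm_inv, Complex.norm_real, Real.norm_eq_abs, abs_of_pos (Real.cosh_pos _)]
  exact inv_le_one_of_one_le₀ (Real.one_le_cosh t)

theorem coshTempered_inv_cosh_fst : CoshTempered (fun z => (((Real.cosh z.1 : ℝ) : ℂ))⁻¹) :=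
  ⟨Continuous.inv₀ (by fun_prop) fun z => ofReal_cosh_ne_zero _, 1, 0,
    fun z => by simpa using norm_inv_cosh_le_one z.1⟩

theorem coshTempered_inv_cosh_snd : CoshTempered (fun z => (((Real.cosh z.2 : ℝ) : ℂ))⁻¹) :=
  ⟨Continuous.inv₀ (by fun_prop) fun z => ofReal_cosh_ne_zero _, 1, 0,
    fun z => by simpa using norm_inv_cosh_le_one z.2⟩

theorem coshTempered_coshExponent : CoshTempered (fun z => (coshExponent z : ℂ)) :=
  .of_abs_le continuous_coshExponent fun z => by rw [abs_of_pos (coshExponent_pos z)]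

theorem coshTempered_inv_coshExponent : CoshTempered (fun z => (coshExponent z : ℂ)⁻¹) := by
  refine ⟨?_, 1, 0, fun z => ?_⟩
  · have := continuous_coshExponent
    exact Continuous.inv₀ (by fun_prop) fun z => Complex.ofReal_ne_zero.2 (coshExponent_pos z).ne'
  · rw [norm_inv, Complex.norm_real, Real.norm_eq_abs, abs_of_pos (coshExponent_pos z)]
    simpa using inv_le_one_of_one_le₀ (one_le_coshExponent z)

/-- Negative powers matter: the power -1 enters the recurrence and the two mixed components of the
tensor solution. -/
theorem coshTempered_zpow (n : ℤ) : CoshTempered (fun z => (coshExponent z : ℂ) ^ n) := by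
  cases n with
  | ofNat n => simpa using coshTempered_coshExponent.pow n
  | negSucc n =>
    simpa [zpow_negSucc, inv_pow] using coshTempered_inv_coshExponent.pow (n + 1)

/-- The integrals `∫∫ exp (2 i τ t) h ^ n exp (-x h)` with `h = cosh t * cosh v ^ 2`. -/
noncomputable def coshIntegral (τ : ℝ) (n : ℤ) : ℝ → ℂ :=
  laplaceIntegral volume coshExponent (fun z => oscFactor τ z * (coshExponent z : ℂ) ^ n)

theorem coshTempered_oscFactor_mul_zpow (τ : ℝ) (n : ℤ) :
    CoshTempered (fun z => oscFactor τ z * (coshExponent z : ℂ) ^ n) :=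
  (coshTempered_oscFactor τ).mul (coshTempered_zpow n)

theorem coshIntegral_hasDerivAt (τ : ℝ) (n : ℤ) {x : ℝ} (hx : 0 < x) :
    HasDerivAt (coshIntegral τ n) (-coshIntegral τ (n + 1) x) x := by
  have := (coshTempered_oscFactor_mul_zpow τ n).laplaceIntegrable.hasDerivAt
    continuous_coshExponent.measurable (Eventually.of_forall fun z => (coshExponent_pos z).le) hx
  refine HasDerivAt.congr_deriv this ?_
  congr 2
  ext z
  rw [zpow_add_one₀ (Complex.ofReal_ne_zero.2 (coshExponent_pos z).ne')]
  ring

theorem coshIntegral_norm_le (τ : ℝ) (n : ℤ) :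
    ∃ C, ∀ x, 1 ≤ x → ‖coshIntegral τ n x‖ ≤ C * Real.exp (-x) :=
  (coshTempered_oscFactor_mul_zpow τ n).laplaceIntegrable.norm_le
    (Eventually.of_forall one_le_coshExponent)

/-- Fubini reduces to slices, on each of which an integrable function with integrable derivative has
derivative of integral zero. No separate boundary estimate is needed. -/
theorem integral_fst_deriv_eq_zero {Ψ Ψ' : ℝ × ℝ → ℂ}
    (hd : ∀ t v, HasDerivAt (fun t => Ψ (t, v)) (Ψ' (t, v)) t)
    (hi : Integrable Ψ) (hi' : Integrable Ψ') : ∫ z, Ψ' z = 0 := by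
  rw [Measure.volume_eq_prod] at hi hi' ⊢
  rw [integral_prod_symm _ hi', ← integral_zero ℝ ℂ]
  refine integral_congr_ae ?_
  filter_upwards [hi.prod_left_ae, hi'.prod_left_ae] with v h1 h2
  exact integral_eq_zero_of_hasDerivAt_of_integrable (fun t => hd t v) h2 h1

theorem integral_snd_deriv_eq_zero {Ψ Ψ' : ℝ × ℝ → ℂ}
    (hd : ∀ t v, HasDerivAt (fun v => Ψ (t, v)) (Ψ' (t, v)) v)
    (hi : Integrable Ψ) (hi' : Integrable Ψ') : ∫ z, Ψ' z = 0 := by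
  rw [Measure.volume_eq_prod] at hi hi' ⊢
  rw [integral_prod _ hi', ← integral_zero ℝ ℂ]
  refine integral_congr_ae ?_
  filter_upwards [hi.prod_right_ae, hi'.prod_right_ae] with t h1 h2
  exact integral_eq_zero_of_hasDerivAt_of_integrable (fun v => hd t v) h2 h1

theorem hasDerivAt_exp_coshExponent_fst (x t v : ℝ) :
    HasDerivAt (fun t => ((Real.exp (-(x * coshExponent (t, v))) : ℝ) : ℂ))
      (-(x * (Real.sinh t * Real.cosh v ^ 2)) * (Real.exp (-(x * coshExponent (t, v))) : ℝ)) t := by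
  have h1 : HasDerivAt (fun t => Real.exp (-(x * (Real.cosh t * Real.cosh v ^ 2)))) _ t :=
    (((Real.hasDerivAt_cosh t).mul_const (Real.cosh v ^ 2)).const_mul x).neg.exp
  refine h1.ofReal_comp.congr_deriv ?_
  simp only [coshExponent, Pi.neg_apply]
  push_cast
  ring

theorem hasDerivAt_exp_coshExponent_snd (x t v : ℝ) :
    HasDerivAt (fun v => ((Real.exp (-(x * coshExponent (t, v))) : ℝ) : ℂ))
      (-(2 * x * (Real.cosh t * Real.cosh v * Real.sinh v)) *
        (Real.exp (-(x * coshExponent (t, v))) : ℝ)) v := by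
  have h1 : HasDerivAt (fun v => Real.exp (-(x * (Real.cosh t * Real.cosh v ^ 2)))) _ v :=
    ((((Real.hasDerivAt_cosh v).pow 2).const_mul (Real.cosh t)).const_mul x).neg.exp
  refine h1.ofReal_comp.congr_deriv ?_
  simp only [coshExponent, Pi.neg_apply, Pi.pow_apply]
  push_cast
  ring

theorem ofReal_sinh_sq (t : ℝ) :
    ((Real.sinh t : ℝ) : ℂ) ^ 2 = ((Real.cosh t : ℝ) : ℂ) ^ 2 - 1 := by
  have := Real.cosh_sq t
  have h : Real.sinh t ^ 2 = Real.cosh t ^ 2 - 1 := by linarith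
  exact_mod_cast h

/-- With e = exp(2iτt) and f = h · exp(-xh), the function Ψ is e ∂ₜf - f ∂ₜe, whose t-derivative is
e (∂ₜ²f + 4τ²f). The identity (∂ₜh)² = h² - cosh⁴ v leaves terms in cosh⁴ v that are not powers of
h. -/
theorem integral_oscFactor_parts_fst (τ x : ℝ) (hx : 0 < x) :
    ∫ z, oscFactor τ z * ((coshExponent z : ℂ) - 3 * x * coshExponent z ^ 2
      + x ^ 2 * coshExponent z ^ 3 + 2 * x * Real.cosh z.2 ^ 4
      - x ^ 2 * coshExponent z * Real.cosh z.2 ^ 4 + 4 * τ ^ 2 * coshExponent z) *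
        (Real.exp (-(x * coshExponent z)) : ℝ) = (0 : ℂ) := by
  have E := coshTempered_oscFactor τ
  have H := coshTempered_coshExponent
  have C := coshTempered_cosh_snd
  have s := coshTempered_sinh_fst
  have c := CoshTempered.const
  refine integral_fst_deriv_eq_zero
    (Ψ := fun z => oscFactor τ z * ((Real.sinh z.1 : ℂ) * Real.cosh z.2 ^ 2 * (1 - x * coshExponent z)
      - 2 * Complex.I * τ * coshExponent z) * (Real.exp (-(x * coshExponent z)) : ℝ))
    (fun t v => ?_) ?_ ?_
  · have h1 := (Real.hasDerivAt_cosh t).ofReal_comp.mul_const ((Real.cosh v ^ 2 : ℝ) : ℂ)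
    have h2 := (Real.hasDerivAt_sinh t).ofReal_comp.mul_const (((Real.cosh v : ℝ) : ℂ) ^ 2)
    have h1' : HasDerivAt (fun t => ((coshExponent (t, v) : ℝ) : ℂ)) _ t :=
      h1.congr_of_eventuallyEq (Eventually.of_forall fun t => by simp [coshExponent])
    have := ((oscFactor_hasDerivAt τ t v).mul ((h2.mul ((h1'.const_mul (x : ℂ)).const_sub 1)).sub
      (h1'.const_mul (2 * Complex.I * τ)))).mul (hasDerivAt_exp_coshExponent_fst x t v)
    refine this.congr_deriv ?_
    simp only [coshExponent, Pi.mul_apply, Pi.sub_apply]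
    have hs := ofReal_sinh_sq t
    have hI := Complex.I_sq
    generalize oscFactor τ (t, v) = e
    generalize Real.exp _ = E
    push_cast at hs ⊢
    generalize Complex.sinh t = S at *
    linear_combination (e * E * (x ^ 2 * Complex.cosh t * Complex.cosh v ^ 6
      - 2 * x * Complex.cosh v ^ 4)) * hs - 4 * τ ^ 2 * Complex.cosh t * Complex.cosh v ^ 2 * e * E * hI
  · exact (E.mul (((s.mul (C.pow 2)).mul ((c 1).sub ((c x).mul H))).sub
      ((c (2 * Complex.I * τ)).mul H))).laplaceIntegrable x hx
  · exact (E.mul ((((((H.sub ((c (3 * x)).mul (H.pow 2))).add ((c (x ^ 2)).mul (H.pow 3))).add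
      ((c (2 * x)).mul (C.pow 4))).sub (((c (x ^ 2)).mul H).mul (C.pow 4)))).add
      ((c (4 * τ ^ 2)).mul H))).laplaceIntegrable x hx

/-- Its role is to remove those cosh⁴ v terms: Ψ is chosen so that its v-derivative, after sinh² v =
cosh² v - 1, contains the same ones and otherwise only powers of h. -/
theorem integral_oscFactor_parts_snd (τ x : ℝ) (hx : 0 < x) :
    ∫ z, oscFactor τ z * ((x : ℂ) ^ 2 * coshExponent z * (1 - Real.cosh z.2 ^ 4)
      + x * (2 * Real.cosh z.2 ^ 4 - 1) - 1 / 4 * (coshExponent z : ℂ)⁻¹) *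
        (Real.exp (-(x * coshExponent z)) : ℝ) = (0 : ℂ) := by
  have E := coshTempered_oscFactor τ
  have H := coshTempered_coshExponent
  have H' := coshTempered_inv_coshExponent
  have C := coshTempered_cosh_snd
  have C' := coshTempered_inv_cosh_snd
  have a' := coshTempered_inv_cosh_fst
  have S := coshTempered_sinh_snd
  have c := CoshTempered.const
  refine integral_snd_deriv_eq_zero
    (Ψ := fun z => oscFactor τ z * ((x : ℂ) / 2 * Real.cosh z.2 * Real.sinh z.2 * (1 + Real.cosh z.2 ^ 2)
      - 1 / 4 * (Real.cosh z.1 : ℂ)⁻¹ * Real.sinh z.2 * (Real.cosh z.2 : ℂ)⁻¹) *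
        (Real.exp (-(x * coshExponent z)) : ℝ))
    (fun t v => ?_) ?_ ?_
  · have hC := (Real.hasDerivAt_cosh v).ofReal_comp
    have hS := (Real.hasDerivAt_sinh v).ofReal_comp
    have := (((((hC.const_mul (x / 2 : ℂ)).mul hS).mul ((hC.pow 2).const_add 1)).sub
      ((hS.const_mul (1 / 4 * (Real.cosh t : ℂ)⁻¹)).mul (hC.inv (ofReal_cosh_ne_zero v)))).const_mul
        (Complex.exp (2 * Complex.I * τ * t))).mul (hasDerivAt_exp_coshExponent_snd x t v)
    refine this.congr_deriv ?_
    simp only [coshExponent, Pi.mul_apply, Pi.sub_apply, Pi.pow_apply, oscFactor, Pi.inv_apply]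
    have hs := ofReal_sinh_sq v
    have h0 := ofReal_cosh_ne_zero v
    have h1 := ofReal_cosh_ne_zero t
    generalize Complex.exp (2 * Complex.I * τ * t) = e
    generalize Real.exp _ = E
    push_cast at hs h0 h1 ⊢
    generalize Complex.sinh v = S at *
    generalize Complex.cosh v = C at *
    generalize Complex.cosh t = a at *
    -- Naming the inverses of cosh t and cosh v makes the identity polynomial modulo ab = 1, CD = 1
    -- and the hyperbolic relation.
    obtain ⟨b, hb⟩ : ∃ b, b = a⁻¹ := ⟨_, rfl⟩
    obtain ⟨D, hD⟩ : ∃ D, D = C⁻¹ := ⟨_, rfl⟩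
    have hab : a * b = 1 := by rw [hb, mul_inv_cancel₀ h1]
    have hCD : C * D = 1 := by rw [hD, mul_inv_cancel₀ h0]
    simp only [div_eq_mul_inv _ (C ^ 2), mul_inv, ← inv_pow, ← hb, ← hD]
    linear_combination (e * E * (x / 2 * (1 + 3 * C ^ 2) + b * D ^ 2 / 4
      - x ^ 2 * a * C ^ 2 * (1 + C ^ 2) + x / 2 * a * b * C * D)) * hs
      + e * E * (b / 4 * C * D + x / 2 * (C ^ 2 - 1)) * hCD
      + e * E * (x / 2 * (C ^ 2 - 1) * C * D) * hab
  · exact (E.mul (((((c (x / 2)).mul C).mul S).mul ((c 1).add (C.pow 2))).sub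
      ((((c (1 / 4)).mul a').mul S).mul C'))).laplaceIntegrable x hx
  · exact (E.mul (((((c (x ^ 2)).mul H).mul ((c 1).sub (C.pow 4))).add ((c x).mul
      (((c 2).mul (C.pow 4)).sub (c 1)))).sub ((c (1 / 4)).mul H'))).laplaceIntegrable x hx

end Kernel

/-! ### Recurrence, decay in τ, and asymptotics in x of the double integral. -/

section KernelIdentities

open MeasureTheory Set Topology

/-- Subtracting the first integration by parts from the second cancels every cosh⁴ v term. The
result is a linear differential equation in x for the double integral. -/
theorem coshIntegral_recurrence (τ : ℝ) {x : ℝ} (hx : 0 < x) :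
    -x ^ 2 * coshIntegral τ 3 x + 3 * x * coshIntegral τ 2 x + x ^ 2 * coshIntegral τ 1 x
      - x * coshIntegral τ 0 x - coshIntegral τ 1 x - 4 * τ ^ 2 * coshIntegral τ 1 x
      - 1 / 4 * coshIntegral τ (-1) x = 0 := by
  obtain ⟨I, hI⟩ : ∃ I : ℤ → ℝ × ℝ → ℂ, I = fun n z => oscFactor τ z * (coshExponent z : ℂ) ^ n *
      (Real.exp (-(x * coshExponent z)) : ℂ) := ⟨_, rfl⟩
  have hint : ∀ n : ℤ, Integrable (I n) := fun n =>
    hI ▸ (coshTempered_oscFactor_mul_zpow τ n).laplaceIntegrable x hx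
  have hK : ∀ n : ℤ, coshIntegral τ n x = ∫ z, I n z := fun _ => hI ▸ rfl
  have s1 := (hint 3).const_mul (-x ^ 2 : ℂ)
  have s2 := s1.add ((hint 2).const_mul (3 * x : ℂ))
  have s3 := s2.add ((hint 1).const_mul (x ^ 2 : ℂ))
  have s4 := s3.sub ((hint 0).const_mul (x : ℂ))
  have s5 := s4.sub (hint 1)
  have s6 := s5.sub ((hint 1).const_mul (4 * τ ^ 2 : ℂ))
  have e1 := integral_oscFactor_parts_fst τ x hx
  have e2 := integral_oscFactor_parts_snd τ x hx
  have h1 : Integrable (fun z => oscFactor τ z * ((coshExponent z : ℂ) - 3 * x * coshExponent z ^ 2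
      + x ^ 2 * coshExponent z ^ 3 + 2 * x * Real.cosh z.2 ^ 4
      - x ^ 2 * coshExponent z * Real.cosh z.2 ^ 4 + 4 * τ ^ 2 * coshExponent z) *
        (Real.exp (-(x * coshExponent z)) : ℝ)) := by
    have c := CoshTempered.const
    have H := coshTempered_coshExponent
    have C := coshTempered_cosh_snd
    exact ((coshTempered_oscFactor τ).mul ((((((H.sub ((c (3 * x)).mul (H.pow 2))).add
      ((c (x ^ 2)).mul (H.pow 3))).add ((c (2 * x)).mul (C.pow 4))).sub
      (((c (x ^ 2)).mul H).mul (C.pow 4)))).add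
      ((c (4 * τ ^ 2)).mul H))).laplaceIntegrable x hx
  have h2 : Integrable (fun z => oscFactor τ z * ((x : ℂ) ^ 2 * coshExponent z *
      (1 - Real.cosh z.2 ^ 4) + x * (2 * Real.cosh z.2 ^ 4 - 1) - 1 / 4 * (coshExponent z : ℂ)⁻¹) *
        (Real.exp (-(x * coshExponent z)) : ℝ)) := by
    have c := CoshTempered.const
    have C := coshTempered_cosh_snd
    exact ((coshTempered_oscFactor τ).mul (((((c (x ^ 2)).mul coshTempered_coshExponent).mul
      ((c 1).sub (C.pow 4))).add ((c x).mul (((c 2).mul (C.pow 4)).sub (c 1)))).sub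
      ((c (1 / 4)).mul coshTempered_inv_coshExponent))).laplaceIntegrable x hx
  have e3 := integral_sub h2 h1
  rw [e1, e2, sub_zero] at e3
  rw [← e3]
  simp only [hK, ← integral_const_mul]
  rw [← integral_add, ← integral_add, ← integral_sub, ← integral_sub, ← integral_sub,
    ← integral_sub]
  · refine integral_congr_ae (Eventually.of_forall fun z => ?_)
    have e3 : (coshExponent z : ℂ) ^ (3 : ℤ) = (coshExponent z : ℂ) ^ 3 := by norm_cast
    have e2 : (coshExponent z : ℂ) ^ (2 : ℤ) = (coshExponent z : ℂ) ^ 2 := by norm_cast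
    simp only [hI, e3, e2, zpow_one, zpow_zero, zpow_neg]
    ring
  exacts [s6, (hint _).const_mul _, s5, (hint _).const_mul _, s4, hint _, s3,
    (hint _).const_mul _, s2, (hint _).const_mul _, s1, (hint _).const_mul _]

/-- Two integrations by parts in t give 4τ² J_τ = -∫∫ exp(2iτt) ∂ₜ² exp(-xh), and the right side is
bounded uniformly in τ. -/
theorem coshIntegral_decay {x : ℝ} (hx : 0 < x) :
    ∃ C, ∀ τ : ℝ, τ ^ 2 * ‖coshIntegral τ 0 x‖ ≤ C := by
  have c := CoshTempered.const
  have H := coshTempered_coshExponent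
  have C := coshTempered_cosh_snd
  have s := coshTempered_sinh_fst
  -- The factor multiplying exp(-xh) in its second t-derivative, -xh + (x ∂ₜh)².
  have W := ((c (-x)).mul H).add ((((c x).mul s).mul (C.pow 2)).pow 2)
  refine ⟨(∫ z, ‖(-x * coshExponent z + (x * Real.sinh z.1 * Real.cosh z.2 ^ 2) ^ 2 : ℂ) *
    (Real.exp (-(x * coshExponent z)) : ℝ)‖), fun τ => ?_⟩
  have E := coshTempered_oscFactor τ
  have key := integral_fst_deriv_eq_zero
    (Ψ := fun z => oscFactor τ z * (-(x * Real.sinh z.1 * Real.cosh z.2 ^ 2)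
      - 2 * Complex.I * τ) * (Real.exp (-(x * coshExponent z)) : ℝ))
    (Ψ' := fun z => oscFactor τ z * (-x * coshExponent z
      + (x * Real.sinh z.1 * Real.cosh z.2 ^ 2) ^ 2) * (Real.exp (-(x * coshExponent z)) : ℝ)
      + 4 * τ ^ 2 * (oscFactor τ z * (coshExponent z : ℂ) ^ (0 : ℤ) *
        (Real.exp (-(x * coshExponent z)) : ℝ)))
    (fun t v => by
      have h2 := ((Real.hasDerivAt_sinh t).ofReal_comp.const_mul (x : ℂ)).mul_const
        (((Real.cosh v : ℝ) : ℂ) ^ 2)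
      have := ((oscFactor_hasDerivAt τ t v).mul (h2.neg.sub_const (2 * Complex.I * τ))).mul
        (hasDerivAt_exp_coshExponent_fst x t v)
      refine this.congr_deriv ?_
      simp only [coshExponent, Pi.mul_apply, Pi.neg_apply, zpow_zero]
      have hI := Complex.I_sq
      generalize oscFactor τ (t, v) = e
      generalize Real.exp _ = E
      push_cast
      linear_combination -4 * τ ^ 2 * e * E * hI)
    ((E.mul ((((c x).mul s).mul (C.pow 2)).neg.sub (c (2 * Complex.I * τ)))).laplaceIntegrable x hx)
    (((E.mul W).laplaceIntegrable x hx).add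
      (((coshTempered_oscFactor_mul_zpow τ 0).laplaceIntegrable x hx).const_mul _))
  rw [integral_add ((E.mul W).laplaceIntegrable x hx)
    (((coshTempered_oscFactor_mul_zpow τ 0).laplaceIntegrable x hx).const_mul _),
    integral_const_mul] at key
  have h4 : (4 * τ ^ 2 : ℂ) * coshIntegral τ 0 x = -∫ z, oscFactor τ z * (-x * coshExponent z
      + (x * Real.sinh z.1 * Real.cosh z.2 ^ 2) ^ 2) * (Real.exp (-(x * coshExponent z)) : ℝ) :=
    eq_neg_of_add_eq_zero_right key
  have h5 := congrArg norm h4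
  rw [norm_neg, norm_mul] at h5
  have h6 : ‖(4 * τ ^ 2 : ℂ)‖ = 4 * τ ^ 2 := by
    have : (4 * τ ^ 2 : ℂ) = ((4 * τ ^ 2 : ℝ) : ℂ) := by push_cast; ring
    rw [this, Complex.norm_real, Real.norm_eq_abs, abs_of_nonneg (by positivity)]
  rw [h6] at h5
  have h7 : τ ^ 2 * ‖coshIntegral τ 0 x‖ ≤ 4 * τ ^ 2 * ‖coshIntegral τ 0 x‖ := by
    nlinarith [mul_nonneg (sq_nonneg τ) (norm_nonneg (coshIntegral τ 0 x))]
  refine h7.trans (h5.trans_le ((norm_integral_le_integral_norm _).trans_eq ?_))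
  refine integral_congr_ae (Eventually.of_forall fun z => ?_)
  simp only [norm_mul, norm_oscFactor, one_mul]

theorem tendsto_sqrt_mul_sinh (a : ℝ) :
    Tendsto (fun x : ℝ => √x * Real.sinh ((√x)⁻¹ * a)) atTop (𝓝 a) := by
  have h1 : HasDerivAt (fun r : ℝ => Real.sinh (r * a)) a 0 := by
    have := ((hasDerivAt_id (0 : ℝ)).mul_const a).sinh
    simpa using this
  have h2 := hasDerivAt_iff_tendsto_slope_zero.1 h1
  have h3 : Tendsto (fun x : ℝ => (√x)⁻¹) atTop (𝓝[≠] 0) := by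
    refine tendsto_nhdsWithin_iff.2 ⟨Real.tendsto_sqrt_atTop.inv_tendsto_atTop, ?_⟩
    filter_upwards [eventually_gt_atTop 0] with x hx
    exact inv_ne_zero (Real.sqrt_pos.2 hx).ne'
  refine (h2.comp h3).congr fun x => ?_
  simp

/-- Write cosh t cosh² v - 1 = 2 sinh²(t/2) cosh² v + sinh² v and pass to the limit in each term. -/
theorem tendsto_rescaled_coshExponent (z : ℝ × ℝ) :
    Tendsto (fun x : ℝ => x * (coshExponent ((√x)⁻¹ • z) - 1)) atTop
      (𝓝 (z.1 ^ 2 / 2 + z.2 ^ 2)) := by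
  have h1 := tendsto_sqrt_mul_sinh (z.1 / 2)
  have h2 := tendsto_sqrt_mul_sinh z.2
  have h0 : Tendsto (fun x : ℝ => (√x)⁻¹) atTop (𝓝 0) := Real.tendsto_sqrt_atTop.inv_tendsto_atTop
  have h3 : Tendsto (fun x : ℝ => Real.cosh ((√x)⁻¹ * z.2)) atTop (𝓝 1) := by
    have := (Real.continuous_cosh.tendsto (0 * z.2)).comp (h0.mul_const z.2)
    simpa [Function.comp_def] using this
  have := (((h1.pow 2).const_mul 2).mul (h3.pow 2)).add (h2.pow 2)
  have e : 2 * (z.1 / 2) ^ 2 * 1 ^ 2 + z.2 ^ 2 = z.1 ^ 2 / 2 + z.2 ^ 2 := by ring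
  rw [e] at this
  refine this.congr' ?_
  filter_upwards [eventually_gt_atTop 0] with x hx
  have hs : √x ^ 2 = x := Real.sq_sqrt hx.le
  have h4 : Real.cosh ((√x)⁻¹ * z.1) = 1 + 2 * Real.sinh ((√x)⁻¹ * (z.1 / 2)) ^ 2 := by
    have := Real.cosh_two_mul ((√x)⁻¹ * (z.1 / 2))
    rw [Real.cosh_sq] at this
    rw [show (√x)⁻¹ * z.1 = 2 * ((√x)⁻¹ * (z.1 / 2)) by ring]
    linarith
  have h5 := Real.cosh_sq ((√x)⁻¹ * z.2)
  simp only [coshExponent, Prod.smul_fst, Prod.smul_snd, smul_eq_mul]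
  rw [h4, mul_pow, mul_pow, hs]
  linear_combination (-x) * h5

/-- Scaling both variables by 1/√x has Jacobian factor x in dimension two; exp x removes the minimum
h = 1. -/
theorem coshIntegral_zero_rescale (τ : ℝ) {x : ℝ} (hx : 0 < x) :
    x * Real.exp x * coshIntegral τ 0 x = ∫ z : ℝ × ℝ, oscFactor τ ((√x)⁻¹ • z) *
      (Real.exp (-(x * (coshExponent ((√x)⁻¹ • z) - 1))) : ℂ) := by
  have h := Measure.integral_comp_smul (volume : Measure (ℝ × ℝ)) (fun z => oscFactor τ z *
      (Real.exp (-(x * (coshExponent z - 1))) : ℂ)) (√x)⁻¹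
  have e : |(((√x)⁻¹ ^ 2))⁻¹| = x := by
    rw [inv_pow, inv_inv, Real.sq_sqrt hx.le, abs_of_pos hx]
  rw [show Module.finrank ℝ (ℝ × ℝ) = 2 by simp, e] at h
  rw [h, coshIntegral, laplaceIntegral, Complex.real_smul, mul_assoc, ← integral_const_mul]
  congr 1
  refine integral_congr_ae (Eventually.of_forall fun z => ?_)
  have : Real.exp (-(x * (coshExponent z - 1))) = Real.exp x * Real.exp (-(x * coshExponent z)) := by
    rw [← Real.exp_add]; ring_nf
  simp only [zpow_zero, this]
  push_cast
  ring

/-- Laplace's method at the minimum of h at the origin. The limit is ∫∫ exp(-t²/2 - v²) = √(2π) ·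
√π, and oscillation disappears since exp(2iτt/√x) tends to 1. -/
theorem tendsto_coshIntegral (τ : ℝ) :
    Tendsto (fun x : ℝ => (x * Real.exp x : ℂ) * coshIntegral τ 0 x) atTop
      (𝓝 ((√2 * Real.pi : ℝ) : ℂ)) := by
  have hg : ∫ z : ℝ × ℝ, ((Real.exp (-(1 / 2) * z.1 ^ 2) * Real.exp (-1 * z.2 ^ 2) : ℝ) : ℂ) =
      ((√2 * Real.pi : ℝ) : ℂ) := by
    rw [integral_complex_ofReal, Measure.volume_eq_prod,
      integral_prod_mul (fun t : ℝ => Real.exp (-(1 / 2) * t ^ 2))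
        (fun t : ℝ => Real.exp (-1 * t ^ 2)), integral_gaussian, integral_gaussian,
      ← Real.sqrt_mul (by positivity)]
    congr 1
    rw [show Real.pi / (1 / 2) * (Real.pi / 1) = 2 * Real.pi ^ 2 by ring,
      Real.sqrt_mul (by positivity), Real.sqrt_sq Real.pi_pos.le]
  rw [← hg]
  have key : Tendsto (fun x : ℝ => ∫ z : ℝ × ℝ, oscFactor τ ((√x)⁻¹ • z) *
      (Real.exp (-(x * (coshExponent ((√x)⁻¹ • z) - 1))) : ℂ)) atTop
      (𝓝 (∫ z : ℝ × ℝ, ((Real.exp (-(1 / 2) * z.1 ^ 2) * Real.exp (-1 * z.2 ^ 2) : ℝ) : ℂ))) := by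
    refine tendsto_integral_filter_of_dominated_convergence
      (fun z => Real.exp (-(1 / 2) * z.1 ^ 2) * Real.exp (-1 * z.2 ^ 2)) ?_ ?_
      ((integrable_exp_neg_mul_sq (by norm_num)).mul_prod (integrable_exp_neg_mul_sq one_pos)) ?_
    · refine Eventually.of_forall fun x => Continuous.aestronglyMeasurable ?_
      have h1 := continuous_oscFactor τ
      have h2 := continuous_coshExponent
      fun_prop
    · filter_upwards [eventually_gt_atTop 0] with x hx
      refine Eventually.of_forall fun z => ?_
      rw [norm_mul, norm_oscFactor, one_mul, Complex.norm_real, Real.norm_eq_abs, Real.abs_exp,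
        ← Real.exp_add]
      gcongr
      have h1 := coshExponent_ge ((√x)⁻¹ • z)
      simp only [Prod.smul_fst, Prod.smul_snd, smul_eq_mul, mul_pow, inv_pow,
        Real.sq_sqrt hx.le] at h1
      have h2 : x * (x⁻¹ * z.1 ^ 2 / 2 + x⁻¹ * z.2 ^ 2) ≤
          x * (coshExponent ((√x)⁻¹ • z) - 1) := by
        gcongr
        linarith
      have h3 : x * (x⁻¹ * z.1 ^ 2 / 2 + x⁻¹ * z.2 ^ 2) = z.1 ^ 2 / 2 + z.2 ^ 2 := by
        field_simp
      linarith
    · refine Eventually.of_forall fun z => ?_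
      have h0 : Tendsto (fun x : ℝ => (√x)⁻¹) atTop (𝓝 0) :=
        Real.tendsto_sqrt_atTop.inv_tendsto_atTop
      have h1 : Tendsto (fun x : ℝ => oscFactor τ ((√x)⁻¹ • z)) atTop (𝓝 1) := by
        have := ((continuous_oscFactor τ).tendsto ((0 : ℝ) • z)).comp (h0.smul_const z)
        simpa [oscFactor, Function.comp_def] using this
      have h2 := (Complex.continuous_ofReal.tendsto _).comp ((Real.continuous_exp.tendsto _).comp
        (tendsto_rescaled_coshExponent z).neg)
      have h3 := h1.mul h2
      rw [one_mul, show -(z.1 ^ 2 / 2 + z.2 ^ 2) = -(1 / 2) * z.1 ^ 2 + -1 * z.2 ^ 2 by ring,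
        Real.exp_add] at h3
      exact h3
  refine key.congr' ?_
  filter_upwards [eventually_gt_atTop 0] with x hx using (coshIntegral_zero_rescale τ hx).symm

end KernelIdentities

/-! ### The linear system for products of solutions, and recognition of the decaying product. -/

section TensorSystem

open MeasureTheory Set Topology

/-- The coefficient `q` of Whittaker's equation in the form `u'' = q u`. -/
noncomputable def whittakerPotential (κ : ℝ) (ν : ℂ) (x : ℝ) : ℂ :=
  -(-(1 / 4 : ℂ) + (κ : ℂ) / (x : ℂ) + (1 / 4 - ν ^ 2) / (x : ℂ) ^ 2)

/-- The first-order system on `(0, ∞)` satisfied by the products `u w`, `u' w`, `u w'`, `u' w'` of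
solutions of `u'' = q₁ u` and `w'' = q₂ w`. -/
structure IsTensorSolution (q₁ q₂ a b c d : ℝ → ℂ) : Prop where
  deriv_a : ∀ x, 0 < x → HasDerivAt a (b x + c x) x
  deriv_b : ∀ x, 0 < x → HasDerivAt b (q₁ x * a x + d x) x
  deriv_c : ∀ x, 0 < x → HasDerivAt c (q₂ x * a x + d x) x
  deriv_d : ∀ x, 0 < x → HasDerivAt d (q₁ x * c x + q₂ x * b x) x

namespace IsTensorSolution

variable {q₁ q₂ a b c d : ℝ → ℂ}

theorem swap (h : IsTensorSolution q₁ q₂ a b c d) : IsTensorSolution q₂ q₁ a c b d :=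
  ⟨fun x hx => by rw [add_comm]; exact h.deriv_a x hx, h.deriv_c, h.deriv_b,
    fun x hx => by rw [add_comm]; exact h.deriv_d x hx⟩

theorem of_solutions {u v w y : ℝ → ℂ} (hu : ∀ x, 0 < x → HasDerivAt u (v x) x)
    (hv : ∀ x, 0 < x → HasDerivAt v (q₁ x * u x) x) (hw : ∀ x, 0 < x → HasDerivAt w (y x) x)
    (hy : ∀ x, 0 < x → HasDerivAt y (q₂ x * w x) x) :
    IsTensorSolution q₁ q₂ (fun x => u x * w x) (fun x => v x * w x) (fun x => u x * y x)
      (fun x => v x * y x) where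
  deriv_a x hx := (hu x hx).mul (hw x hx)
  deriv_b x hx := ((hv x hx).mul (hw x hx)).congr_deriv (by ring)
  deriv_c x hx := ((hu x hx).mul (hy x hx)).congr_deriv (by ring)
  deriv_d x hx := ((hv x hx).mul (hy x hx)).congr_deriv (by ring)

theorem const_mul (h : IsTensorSolution q₁ q₂ a b c d) (k : ℂ) :
    IsTensorSolution q₁ q₂ (fun x => k * a x) (fun x => k * b x) (fun x => k * c x)
      (fun x => k * d x) where
  deriv_a x hx := ((h.deriv_a x hx).const_mul k).congr_deriv (by ring)
  deriv_b x hx := ((h.deriv_b x hx).const_mul k).congr_deriv (by ring)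
  deriv_c x hx := ((h.deriv_c x hx).const_mul k).congr_deriv (by ring)
  deriv_d x hx := ((h.deriv_d x hx).const_mul k).congr_deriv (by ring)

/-- Two solutions that agree at a point agree to the left of it. -/
theorem unique_left {a' b' c' d' : ℝ → ℂ} (hq₁ : ContinuousOn q₁ (Ioi 0))
    (hq₂ : ContinuousOn q₂ (Ioi 0)) (h : IsTensorSolution q₁ q₂ a b c d)
    (h' : IsTensorSolution q₁ q₂ a' b' c' d') {x y : ℝ} (hx : 0 < x) (hxy : x ≤ y)
    (ha : a y = a' y) (hb : b y = b' y) (hc : c y = c' y) (hd : d y = d' y) : a x = a' x := by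
  have hsub : Icc x y ⊆ Ioi 0 := fun t ht => hx.trans_le ht.1
  obtain ⟨C₁, hC₁⟩ := isCompact_Icc.exists_bound_of_continuousOn (hq₁.mono hsub)
  obtain ⟨C₂, hC₂⟩ := isCompact_Icc.exists_bound_of_continuousOn (hq₂.mono hsub)
  set C : ℝ := 1 + |C₁| + |C₂| with hC
  have hCpos : 0 ≤ C := by positivity
  have hder : ∀ {a b c d : ℝ → ℂ}, IsTensorSolution q₁ q₂ a b c d → ∀ t, 0 < t →
      HasDerivAt (fun t => (a t, b t, c t, d t))
        (b t + c t, q₁ t * a t + d t, q₂ t * a t + d t, q₁ t * c t + q₂ t * b t) t :=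
    fun h t ht => (h.deriv_a t ht).prodMk ((h.deriv_b t ht).prodMk
      ((h.deriv_c t ht).prodMk (h.deriv_d t ht)))
  -- Each component is a sum of two terms that are C-Lipschitz for the sup metric, hence the
  -- constant 2C.
  have key := ODE_solution_unique_of_mem_Icc_left (a := x) (b := y) (K := Real.toNNReal (2 * C))
    (v := fun t (p : ℂ × ℂ × ℂ × ℂ) => (p.2.1 + p.2.2.1, q₁ t * p.1 + p.2.2.2,
      q₂ t * p.1 + p.2.2.2, q₁ t * p.2.2.1 + q₂ t * p.2.1)) (s := fun _ => univ)
    (f := fun t => (a t, b t, c t, d t)) (g := fun t => (a' t, b' t, c' t, d' t))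
    (fun t ht => by
      have ht' : t ∈ Icc x y := ⟨ht.1.le, ht.2⟩
      have h1 : ‖q₁ t‖ ≤ C := by
        have := (hC₁ t ht').trans (le_abs_self C₁)
        have := abs_nonneg C₂
        linarith
      have h2 : ‖q₂ t‖ ≤ C := by
        have := (hC₂ t ht').trans (le_abs_self C₂)
        have := abs_nonneg C₁
        linarith
      have h3 : (1 : ℝ) ≤ C := by
        have := abs_nonneg C₁
        have := abs_nonneg C₂
        linarith
      refine LipschitzOnWith.of_dist_le_mul fun p _ r _ => ?_
      rw [Real.coe_toNNReal _ (by positivity)]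
      have e1 : dist p.1 r.1 ≤ dist p r := le_max_left _ _
      have e2' : dist p.2 r.2 ≤ dist p r := le_max_right _ _
      have e2 : dist p.2.1 r.2.1 ≤ dist p r := le_trans (le_max_left _ _) e2'
      have e3' : dist p.2.2 r.2.2 ≤ dist p r := le_trans (le_max_right _ _) e2'
      have e3 : dist p.2.2.1 r.2.2.1 ≤ dist p r := le_trans (le_max_left _ _) e3'
      have e4 : dist p.2.2.2 r.2.2.2 ≤ dist p r := le_trans (le_max_right _ _) e3'
      have hm : ∀ {s z z' : ℂ}, ‖s‖ ≤ C → dist z z' ≤ dist p r →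
          dist (s * z) (s * z') ≤ C * dist p r := by
        intro s z z' hs hz
        rw [dist_eq_norm, ← mul_sub, norm_mul, ← dist_eq_norm]
        gcongr
      have ho : ∀ {z z' : ℂ}, dist z z' ≤ dist p r → dist z z' ≤ C * dist p r := fun hz =>
        hz.trans (le_mul_of_one_le_left dist_nonneg h3)
      have hadd : ∀ {z z' s s' : ℂ}, dist z z' ≤ C * dist p r → dist s s' ≤ C * dist p r →
          dist (z + s) (z' + s') ≤ 2 * C * dist p r := fun hz hs =>
        (dist_add_add_le _ _ _ _).trans (by linarith)
      exact max_le (hadd (ho e2) (ho e3)) (max_le (hadd (hm h1 e1) (ho e4))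
        (max_le (hadd (hm h2 e1) (ho e4)) (hadd (hm h1 e3) (hm h2 e2)))))
    (fun t ht => (hder h t (hx.trans_le ht.1)).continuousAt.continuousWithinAt)
    (fun t ht => (hder h t (hx.trans ht.1)).hasDerivWithinAt)
    (fun _ _ => trivial)
    (fun t ht => (hder h' t (hx.trans_le ht.1)).continuousAt.continuousWithinAt)
    (fun t ht => (hder h' t (hx.trans ht.1)).hasDerivWithinAt)
    (fun _ _ => trivial)
    (by simp only [ha, hb, hc, hd])
  exact congrArg Prod.fst (key ⟨le_rfl, hxy⟩)

end IsTensorSolution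

theorem continuousOn_whittakerPotential (κ : ℝ) (ν : ℂ) :
    ContinuousOn (whittakerPotential κ ν) (Ioi 0) := by
  have hne : ∀ t ∈ Ioi (0 : ℝ), (t : ℂ) ≠ 0 := fun t ht => by
    exact_mod_cast (show (0 : ℝ) < t from ht).ne'
  have hof : ContinuousOn (fun t : ℝ => (t : ℂ)) (Ioi 0) :=
    Complex.continuous_ofReal.continuousOn
  exact ((continuousOn_const.add (continuousOn_const.div hof hne)).add
    (continuousOn_const.div (hof.pow 2) fun t ht => pow_ne_zero 2 (hne t ht))).neg

/-- The rate 3/4 is an arbitrary number between 1/2, the rate of one Whittaker function, and 1, the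
rate of the product. -/
theorem isLittleO_exp_whittaker (κ : ℝ) :
    (fun x : ℝ => Real.exp (-(3 / 4) * x)) =o[atTop]
      fun x : ℝ => ((x ^ κ * Real.exp (-x / 2) : ℝ) : ℂ) := by
  have h1 := isLittleO_exp_neg_mul_rpow_atTop (a := 1 / 4) (by norm_num) κ
  have h2 := h1.mul_isBigO (isBigO_refl (fun x : ℝ => Real.exp (-x / 2)) atTop)
  refine (h2.congr_left fun x => ?_).trans_isBigO ?_
  · rw [← Real.exp_add]; ring_nf
  · exact IsBigO.of_bound 1 (Eventually.of_forall fun x => by rw [Complex.norm_real, one_mul])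

/-- A rapidly decaying solution of the tensor system is degenerate in the first factor. -/
theorem IsTensorSolution.contraction {κ₁ κ₂ : ℝ} {ν : ℂ} {u v w a b c d : ℝ → ℂ}
    (hu : ∀ x, 0 < x → HasDerivAt u (v x) x)
    (hv : ∀ x, 0 < x → HasDerivAt v (whittakerPotential κ₁ ν x * u x) x)
    (hubd : u =O[atTop] fun _ => (1 : ℝ)) (hvbd : v =O[atTop] fun _ => (1 : ℝ))
    (hw : IsWhittakerW κ₂ ν w)
    (h : IsTensorSolution (whittakerPotential κ₁ ν) (whittakerPotential κ₂ ν) a b c d)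
    (ha : a =O[atTop] fun x : ℝ => Real.exp (-(3 / 4) * x))
    (hb : b =O[atTop] fun x : ℝ => Real.exp (-(3 / 4) * x)) {x : ℝ} (hx : 0 < x) :
    u x * b x = v x * a x ∧ u x * d x = v x * c x := by
  -- A Wronskian with u in the first tensor factor: the κ₁ potential cancels, and (y, z) solves the
  -- first-order form of the κ₂ equation.
  set y : ℝ → ℂ := fun x => u x * b x - v x * a x with hy
  set z : ℝ → ℂ := fun x => u x * d x - v x * c x with hz
  have hyd : ∀ x, 0 < x → HasDerivAt y (z x) x := fun x hx =>
    (((hu x hx).mul (h.deriv_b x hx)).sub ((hv x hx).mul (h.deriv_a x hx))).congr_deriv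
      (by simp only [hz]; ring)
  have hzd : ∀ x, 0 < x → HasDerivAt z (whittakerPotential κ₂ ν x * y x) x := fun x hx =>
    (((hu x hx).mul (h.deriv_d x hx)).sub ((hv x hx).mul (h.deriv_c x hx))).congr_deriv
      (by simp only [hy]; ring)
  have hyo : y =o[atTop] fun x : ℝ => ((x ^ κ₂ * Real.exp (-x / 2) : ℝ) : ℂ) := by
    refine IsBigO.trans_isLittleO ?_ (isLittleO_exp_whittaker κ₂)
    have h1 := (hubd.mul hb).sub (hvbd.mul ha)
    simpa only [one_mul] using h1
  obtain ⟨⟨w', hw'⟩, hwe⟩ := hw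
  -- As y is negligible against w, adding it preserves both defining conditions, and uniqueness then
  -- gives y = 0.
  have hsum : IsWhittakerW κ₂ ν (w + y) := by
    refine ⟨⟨w' + z, fun x hx => ⟨(hw' x hx).1.add (hyd x hx), ?_⟩⟩, hwe.add_isLittleO hyo⟩
    refine ((hw' x hx).2.add (hzd x hx)).congr_deriv ?_
    simp only [whittakerPotential, Pi.add_apply]
    ring
  have hy0 : ∀ x, 0 < x → y x = 0 := by
    intro x hx
    have := IsWhittakerW.unique ⟨⟨w', hw'⟩, hwe⟩ hsum hx
    simpa using this
  have hz0 : z x = 0 := by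
    refine (hyd x hx).unique ((hasDerivAt_const x (0 : ℂ)).congr_of_eventuallyEq ?_)
    filter_upwards [Ioi_mem_nhds hx] with t ht using hy0 t ht
  exact ⟨sub_eq_zero.1 (hy0 x hx), sub_eq_zero.1 hz0⟩

theorem whittaker_isBigO_one {κ : ℝ} {ν : ℂ} {u : ℝ → ℂ} (h : IsWhittakerW κ ν u) :
    u =O[atTop] fun _ => (1 : ℝ) := by
  refine h.2.isBigO.trans ?_
  have h0 : Tendsto (fun x : ℝ => x ^ κ * Real.exp (-(1 / 2) * x)) atTop (𝓝 0) :=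
    tendsto_rpow_mul_exp_neg_mul_atTop_nhds_zero _ _ (by norm_num)
  refine IsBigO.trans ?_ (h0.isBigO_one ℝ)
  refine IsBigO.of_bound 1 (Eventually.of_forall fun x => ?_)
  rw [Complex.norm_real, one_mul, show -x / 2 = -(1 / 2) * x by ring]

/-- A rapidly decaying solution of the tensor system with the asymptotics of the product of two
Whittaker functions is that product. -/
theorem IsTensorSolution.eq_mul {κ₁ κ₂ : ℝ} {ν : ℂ} {u v w y a b c d : ℝ → ℂ}
    (huW : IsWhittakerW κ₁ ν u) (hu : ∀ x, 0 < x → HasDerivAt u (v x) x)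
    (hv : ∀ x, 0 < x → HasDerivAt v (whittakerPotential κ₁ ν x * u x) x)
    (hvbd : v =O[atTop] fun _ => (1 : ℝ))
    (hwW : IsWhittakerW κ₂ ν w) (hw : ∀ x, 0 < x → HasDerivAt w (y x) x)
    (hy : ∀ x, 0 < x → HasDerivAt y (whittakerPotential κ₂ ν x * w x) x)
    (hybd : y =O[atTop] fun _ => (1 : ℝ))
    (h : IsTensorSolution (whittakerPotential κ₁ ν) (whittakerPotential κ₂ ν) a b c d)
    (ha : a =O[atTop] fun x : ℝ => Real.exp (-(3 / 4) * x))
    (hb : b =O[atTop] fun x : ℝ => Real.exp (-(3 / 4) * x))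
    (hc : c =O[atTop] fun x : ℝ => Real.exp (-(3 / 4) * x))
    (has : a ~[atTop] fun x : ℝ => ((x ^ κ₁ * Real.exp (-x / 2) : ℝ) : ℂ) *
      ((x ^ κ₂ * Real.exp (-x / 2) : ℝ) : ℂ)) {x : ℝ} (hx : 0 < x) :
    a x = u x * w x := by
  have h1 : ∀ x, 0 < x → u x * b x = v x * a x ∧ u x * d x = v x * c x := fun x hx =>
    h.contraction hu hv (whittaker_isBigO_one huW) hvbd hwW ha hb hx
  have h2 : ∀ x, 0 < x → w x * c x = y x * a x := fun x hx =>
    (h.swap.contraction hw hy (whittaker_isBigO_one hwW) hybd huW ha hc hx).1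
  have hg : ∀ κ : ℝ, ∀ᶠ x : ℝ in atTop, ((x ^ κ * Real.exp (-x / 2) : ℝ) : ℂ) ≠ 0 := by
    intro κ
    filter_upwards [eventually_gt_atTop 0] with x hx
    have : 0 < x ^ κ * Real.exp (-x / 2) := by positivity
    exact_mod_cast this.ne'
  have hne : ∀ {κ : ℝ} {f : ℝ → ℂ}, IsWhittakerW κ ν f → ∀ᶠ x in atTop, f x ≠ 0 := by
    intro κ f hf
    have := (isEquivalent_iff_tendsto_one (hg κ)).1 hf.2
    filter_upwards [this.eventually_ne one_ne_zero] with x hx h0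
    simp [h0] at hx
  have hlim : Tendsto (fun x => a x / (u x * w x)) atTop (𝓝 1) := by
    have e1 := has.trans (huW.2.mul hwW.2).symm
    refine (isEquivalent_iff_tendsto_one ?_).1 e1
    filter_upwards [hne huW, hne hwW] with x h1 h2 using mul_ne_zero h1 h2
  obtain ⟨A, hA⟩ := eventually_atTop.1 ((hne huW).and ((hne hwW).and (eventually_gt_atTop 0)))
  -- The contractions say b/a = v/u and c/a = y/w wherever a ≠ 0, so a and uw have the same
  -- logarithmic derivative; in multiplied-out form this needs only u, w ≠ 0, true beyond A.
  have hz : ∀ s, A ≤ s → HasDerivAt (fun x => a x / (u x * w x)) 0 s := by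
    intro s hs
    obtain ⟨hu0, hw0, hs0⟩ := hA s hs
    refine ((h.deriv_a s hs0).div ((hu s hs0).mul (hw s hs0))
      (mul_ne_zero hu0 hw0)).congr_deriv ?_
    rw [div_eq_zero_iff]
    left
    simp only [Pi.mul_apply]
    linear_combination w s * (h1 s hs0).1 + u s * h2 s hs0
  have hconst : ∀ t, A ≤ t → a t / (u t * w t) = a A / (u A * w A) := fun t ht =>
    constant_of_has_deriv_right_zero
      (fun s hs => (hz s hs.1).continuousAt.continuousWithinAt)
      (fun s hs => (hz s hs.1).hasDerivWithinAt) t ⟨ht, le_rfl⟩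
  have hone : a A / (u A * w A) = 1 := by
    refine tendsto_nhds_unique (Tendsto.congr' ?_ tendsto_const_nhds) hlim
    filter_upwards [eventually_ge_atTop A] with t ht using (hconst t ht).symm
  -- All four components are matched at B, where division by u and w is allowed; uniqueness for the
  -- linear system carries the equality left to x, where u or w may vanish.
  obtain ⟨B, hB⟩ : ∃ B, B = max x A := ⟨_, rfl⟩
  have hAB : A ≤ B := hB ▸ le_max_right _ _
  obtain ⟨hu0, hw0, hB0⟩ := hA B hAB
  have eA : a B = u B * w B := by
    have := hconst B hAB
    rwa [hone, div_eq_one_iff_eq (mul_ne_zero hu0 hw0)] at this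
  have eB : b B = v B * w B := by
    apply mul_left_cancel₀ hu0
    rw [(h1 B hB0).1, eA]; ring
  have eC : c B = u B * y B := by
    apply mul_left_cancel₀ hw0
    rw [h2 B hB0, eA]; ring
  have eD : d B = v B * y B := by
    apply mul_left_cancel₀ hu0
    rw [(h1 B hB0).2, eC]; ring
  exact h.unique_left (continuousOn_whittakerPotential _ _) (continuousOn_whittakerPotential _ _)
    (of_solutions hu hv hw hy) hx (hB ▸ le_max_left _ _) eA eB eC eD

end TensorSystem

/-! ### The product formula. -/

section Product

open MeasureTheory Set Topology

theorem coshIntegral_isBigO (τ : ℝ) (n : ℤ) :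
    coshIntegral τ n =O[atTop] fun x : ℝ => Real.exp (-(3 / 4) * x) := by
  obtain ⟨C, hC⟩ := coshIntegral_norm_le τ n
  refine IsBigO.trans (IsBigO.of_bound C ?_ : _ =O[atTop] fun x : ℝ => Real.exp (-x)) ?_
  · filter_upwards [eventually_ge_atTop 1] with x hx
    rw [Real.norm_eq_abs, Real.abs_exp]
    exact hC x hx
  · refine IsBigO.of_bound 1 ?_
    filter_upwards [eventually_ge_atTop 0] with x hx
    simp only [Real.norm_eq_abs, Real.abs_exp, one_mul]
    gcongr
    linarith

theorem id_mul_coshIntegral_isBigO (τ : ℝ) (n : ℤ) :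
    (fun x : ℝ => (x : ℂ) * coshIntegral τ n x) =O[atTop]
      fun x : ℝ => Real.exp (-(3 / 4) * x) := by
  obtain ⟨C, hC⟩ := coshIntegral_norm_le τ n
  refine IsBigO.of_bound (4 * C) ?_
  filter_upwards [eventually_ge_atTop 1] with x hx
  rw [norm_mul, Complex.norm_real, Real.norm_eq_abs, Real.norm_eq_abs, Real.abs_exp,
    abs_of_nonneg (by linarith)]
  have h1 := Real.add_one_le_exp (1 / 4 * x)
  have h2 : Real.exp (-(3 / 4) * x) = Real.exp (1 / 4 * x) * Real.exp (-x) := by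
    rw [← Real.exp_add]; ring_nf
  have h3 := hC x hx
  rw [h2]
  calc x * ‖coshIntegral τ n x‖ ≤ (4 * Real.exp (1 / 4 * x)) * (C * Real.exp (-x)) :=
        mul_le_mul (by linarith) h3 (norm_nonneg _) (by positivity)
    _ = _ := by ring

/-- The components are forced by a = x J₀, where Jₙ carries hⁿ and Jₙ' = -Jₙ₊₁. One has b + c = a';
also (b - c)' = (q₁ - q₂) a = J₀/2, whose decaying primitive is -J₋₁/2; and d = (a'' - (q₁ + q₂)
a)/2. Only the equation for d' uses the recurrence. -/
theorem isTensorSolution_coshIntegral (τ : ℝ) :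
    IsTensorSolution (whittakerPotential (-1 / 4) (Complex.I * τ))
      (whittakerPotential (1 / 4) (Complex.I * τ))
      (fun x => x * coshIntegral τ 0 x)
      (fun x => 1 / 2 * (coshIntegral τ 0 x - x * coshIntegral τ 1 x
        - 1 / 2 * coshIntegral τ (-1) x))
      (fun x => 1 / 2 * (coshIntegral τ 0 x - x * coshIntegral τ 1 x
        + 1 / 2 * coshIntegral τ (-1) x))
      (fun x => 1 / 2 * (-2 * coshIntegral τ 1 x + x * coshIntegral τ 2 x
        - (x / 2 - 2 * (τ ^ 2 + 1 / 4) * (x : ℂ)⁻¹) * coshIntegral τ 0 x)) := by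
  have hid : ∀ x : ℝ, HasDerivAt (fun x : ℝ => (x : ℂ)) 1 x := fun x => by
    simpa using (hasDerivAt_id x).ofReal_comp
  have hI := Complex.I_sq
  refine ⟨fun x hx => ?_, fun x hx => ?_, fun x hx => ?_, fun x hx => ?_⟩
  all_goals
    have hx' : (x : ℂ) ≠ 0 := by exact_mod_cast hx.ne'
    have d0 := coshIntegral_hasDerivAt τ 0 hx
    have d1 := coshIntegral_hasDerivAt τ 1 hx
    have d2 := coshIntegral_hasDerivAt τ 2 hx
    have d3 := coshIntegral_hasDerivAt τ (-1) hx
    norm_num at d0 d1 d2 d3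
  · refine ((hid x).mul d0).congr_deriv ?_
    ring
  · refine (((d0.sub ((hid x).mul d1)).sub (d3.const_mul (1 / 2))).const_mul (1 / 2)).congr_deriv ?_
    simp only [whittakerPotential, mul_pow, hI]
    push_cast
    field_simp
    ring
  · refine (((d0.sub ((hid x).mul d1)).add (d3.const_mul (1 / 2))).const_mul (1 / 2)).congr_deriv ?_
    simp only [whittakerPotential, mul_pow, hI]
    push_cast
    field_simp
    ring
  · refine ((((d1.const_mul (-2)).add ((hid x).mul d2)).sub
      ((((hid x).div_const 2).sub (((hid x).inv hx').const_mul (2 * (τ ^ 2 + 1 / 4 : ℂ)))).mul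
        d0)).const_mul (1 / 2)).congr_deriv ?_
    have hrec := coshIntegral_recurrence τ hx
    have e3 : coshIntegral τ 3 x = (3 * x * coshIntegral τ 2 x + x ^ 2 * coshIntegral τ 1 x
      - x * coshIntegral τ 0 x - coshIntegral τ 1 x - 4 * τ ^ 2 * coshIntegral τ 1 x
      - 1 / 4 * coshIntegral τ (-1) x) / x ^ 2 := by
      rw [eq_div_iff (pow_ne_zero 2 hx')]
      linear_combination -hrec
    simp only [whittakerPotential, mul_pow, hI, e3, Pi.sub_apply, Pi.inv_apply]
    push_cast
    field_simp
    ring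

theorem whittakerW_mul_whittakerW (τ : ℝ) {x : ℝ} (hx : 0 < x) :
    whittakerW (-1 / 4) (Complex.I * τ) x * whittakerW (1 / 4) (Complex.I * τ) x =
      ((x / (√2 * Real.pi) : ℝ) : ℂ) * coshIntegral τ 0 x := by
  obtain ⟨u, v, hu, huv, hv⟩ := exists_isWhittakerW (κ := -1 / 4) (ν := Complex.I * τ)
    (by simp; norm_num) (by simp; norm_num)
  obtain ⟨w, y, hw, hwy, hy⟩ := exists_isWhittakerW (κ := 1 / 4) (ν := Complex.I * τ)
    (by simp; norm_num) (by simp; norm_num)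
  rw [hu.eq_whittakerW hx, hw.eq_whittakerW hx]
  have hpot : ∀ (κ : ℝ) (x : ℝ) (f : ℂ), -((-(1 / 4 : ℂ) + (κ : ℂ) / (x : ℂ) +
      (1 / 4 - (Complex.I * τ) ^ 2) / (x : ℂ) ^ 2) * f) =
      whittakerPotential κ (Complex.I * τ) x * f := fun κ x f => by
    rw [whittakerPotential]; ring
  -- The normalisation: x exp(x) J_τ(x) tends to √2 π, while the opposite powers x^(∓1/4) cancel,
  -- leaving exp(-x) for the product.
  obtain ⟨k, hk⟩ : ∃ k : ℂ, k = ((1 / (√2 * Real.pi) : ℝ) : ℂ) := ⟨_, rfl⟩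
  have hX := (isTensorSolution_coshIntegral τ).const_mul k
  have b0 := coshIntegral_isBigO τ 0
  have b1 := id_mul_coshIntegral_isBigO τ 1
  have b2 := coshIntegral_isBigO τ (-1)
  have h := hX.eq_mul hu (fun x hx => (huv x hx).1)
    (fun x hx => by rw [← hpot]; exact (huv x hx).2) hv
    hw (fun x hx => (hwy x hx).1) (fun x hx => by rw [← hpot]; exact (hwy x hx).2) hy
    ((id_mul_coshIntegral_isBigO τ 0).const_mul_left k)
    ((((b0.sub b1).sub (b2.const_mul_left (1 / 2))).const_mul_left (1 / 2)).const_mul_left k)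
    ((((b0.sub b1).add (b2.const_mul_left (1 / 2))).const_mul_left (1 / 2)).const_mul_left k)
    (by
      have hg : ∀ᶠ x : ℝ in atTop, ((x ^ (-1 / 4 : ℝ) * Real.exp (-x / 2) : ℝ) : ℂ) *
          ((x ^ (1 / 4 : ℝ) * Real.exp (-x / 2) : ℝ) : ℂ) = ((Real.exp x : ℝ) : ℂ)⁻¹ := by
        filter_upwards [eventually_gt_atTop 0] with x hx
        rw [← Complex.ofReal_mul, ← Complex.ofReal_inv, ← Real.exp_neg]
        congr 1
        calc _ = (x ^ (-1 / 4 : ℝ) * x ^ (1 / 4 : ℝ)) *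
              (Real.exp (-x / 2) * Real.exp (-x / 2)) := by ring
          _ = _ := by
            rw [← Real.rpow_add hx, ← Real.exp_add]
            norm_num
      refine (isEquivalent_iff_tendsto_one ?_).2 ?_
      · filter_upwards [hg] with x hx
        rw [hx]
        exact inv_ne_zero (Complex.ofReal_ne_zero.2 (Real.exp_pos x).ne')
      · have hlim := (tendsto_coshIntegral τ).const_mul k
        rw [hk, ← Complex.ofReal_mul, one_div_mul_cancel (by positivity), Complex.ofReal_one,
          ← hk] at hlim
        refine hlim.congr' ?_
        filter_upwards [hg] with x hx
        rw [Pi.div_apply, hx, div_inv_eq_mul]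
        ring) hx
  rw [← h, hk, div_eq_mul_one_div x]
  push_cast
  ring

end Product

/-! ### The Bessel kernel and the pair of Fourier transforms. -/

section FourierPair

open MeasureTheory Set Topology FourierTransform

/-- The function `exp (-y) * K_0 (y)` at `y = x / 2 * cosh (ξ / 2)`, as an integral over the line. -/
noncomputable def besselKernel (x ξ : ℝ) : ℝ := ∫ v, Real.exp (-(x * coshExponent (ξ / 2, v)))

/-- Put u = 2v and use y + y cosh 2v = 2y cosh² v; evenness in v extends the half-line integral to
the line. -/
theorem exp_neg_mul_besselK_zero (y : ℝ) :
    (Real.exp (-y) : ℂ) * besselK 0 y =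
      ((∫ v, Real.exp (-(2 * y * Real.cosh v ^ 2)) : ℝ) : ℂ) := by
  have h1 : besselK 0 y = ((∫ u in Ioi (0 : ℝ), Real.exp (-y * Real.cosh u) : ℝ) : ℂ) := by
    rw [besselK, ← integral_complex_ofReal]
    simp
  have h2 := integral_comp_abs (f := fun v => Real.exp (-(2 * y * Real.cosh v ^ 2)))
  have h3 := integral_comp_mul_left_Ioi (fun u => Real.exp (-y) * Real.exp (-y * Real.cosh u)) 0
    (two_pos : (0 : ℝ) < 2)
  simp only [Real.cosh_abs] at h2
  rw [h1, h2, ← Complex.ofReal_mul, ← integral_const_mul]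
  rw [mul_zero, smul_eq_mul] at h3
  congr 1
  have h4 : ∀ v : ℝ, Real.exp (-y) * Real.exp (-y * Real.cosh (2 * v)) =
      Real.exp (-(2 * y * Real.cosh v ^ 2)) := fun v => by
    rw [← Real.exp_add, Real.cosh_two_mul, Real.sinh_sq]
    ring_nf
  simp only [h4] at h3
  rw [h3]
  ring

theorem besselKernel_eq (x ξ : ℝ) :
    (Real.exp (-(x / 2) * Real.cosh (ξ / 2)) : ℂ) * besselK 0 (x / 2 * Real.cosh (ξ / 2)) =
      (besselKernel x ξ : ℂ) := by
  rw [neg_mul, exp_neg_mul_besselK_zero, besselKernel]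
  congr 2
  ext v
  rw [coshExponent]
  ring_nf

variable {x : ℝ}

theorem exp_neg_coshExponent_le (hx : 0 < x) (t v : ℝ) :
    Real.exp (-(x * coshExponent (t, v))) ≤
      Real.exp (-(x * (t ^ 2 / 2))) * Real.exp (-x * v ^ 2) := by
  rw [← Real.exp_add]
  gcongr
  have := coshExponent_ge (t, v)
  simp only at this
  nlinarith

theorem continuous_besselKernel (hx : 0 < x) : Continuous (besselKernel x) := by
  refine continuous_of_dominated (bound := fun v => Real.exp (-x * v ^ 2)) (fun ξ => ?_)
    (fun ξ => Eventually.of_forall fun v => ?_) (integrable_exp_neg_mul_sq hx)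
    (Eventually.of_forall fun v => ?_)
  · have := continuous_coshExponent
    exact Continuous.aestronglyMeasurable (by fun_prop)
  · rw [Real.norm_eq_abs, Real.abs_exp]
    refine (exp_neg_coshExponent_le hx _ _).trans (mul_le_of_le_one_left (Real.exp_pos _).le ?_)
    rw [Real.exp_le_one_iff, neg_nonpos]
    positivity
  · have := continuous_coshExponent
    fun_prop

theorem besselKernel_nonneg (ξ : ℝ) : 0 ≤ besselKernel x ξ :=
  integral_nonneg fun _ => (Real.exp_pos _).le

theorem besselKernel_decay (hx : 0 < x) : ∃ C, ∀ ξ, ξ ^ 2 * besselKernel x ξ ≤ C := by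
  refine ⟨8 / x * ∫ v : ℝ, Real.exp (-x * v ^ 2), fun ξ => ?_⟩
  have h1 : besselKernel x ξ ≤ Real.exp (-(x * ((ξ / 2) ^ 2 / 2))) *
      ∫ v : ℝ, Real.exp (-x * v ^ 2) := by
    rw [besselKernel, ← integral_const_mul]
    exact integral_mono_of_nonneg (Eventually.of_forall fun _ => (Real.exp_pos _).le)
      ((integrable_exp_neg_mul_sq hx).const_mul _)
      (Eventually.of_forall fun v => exp_neg_coshExponent_le hx _ _)
  have h2 : ξ ^ 2 * Real.exp (-(x * ((ξ / 2) ^ 2 / 2))) ≤ 8 / x := by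
    have := Real.add_one_le_exp (x * ((ξ / 2) ^ 2 / 2))
    rw [Real.exp_neg, ← div_eq_mul_inv, div_le_div_iff₀ (Real.exp_pos _) hx]
    nlinarith
  have h3 : 0 ≤ ∫ v : ℝ, Real.exp (-x * v ^ 2) := integral_nonneg fun _ => (Real.exp_pos _).le
  calc ξ ^ 2 * besselKernel x ξ ≤ ξ ^ 2 * (Real.exp (-(x * ((ξ / 2) ^ 2 / 2))) *
        ∫ v : ℝ, Real.exp (-x * v ^ 2)) := by gcongr
    _ = (ξ ^ 2 * Real.exp (-(x * ((ξ / 2) ^ 2 / 2)))) * ∫ v : ℝ, Real.exp (-x * v ^ 2) := by ring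
    _ ≤ _ := by gcongr

theorem integrable_of_sq_mul_norm_le {f : ℝ → ℂ} (hf : Continuous f)
    (hC : ∃ C, ∀ t, t ^ 2 * ‖f t‖ ≤ C) (hB : ∃ B, ∀ t, ‖f t‖ ≤ B) : Integrable f := by
  obtain ⟨C, hC⟩ := hC
  obtain ⟨B, hB⟩ := hB
  refine (integrable_inv_one_add_sq.const_mul (B + C)).mono' hf.aestronglyMeasurable
    (Eventually.of_forall fun t => ?_)
  rw [← div_eq_mul_inv, le_div_iff₀ (by positivity)]
  nlinarith [hC t, hB t]

theorem isBigO_cocompact_of_sq_mul_norm_le {f : ℝ → ℂ} (hC : ∃ C, ∀ t, t ^ 2 * ‖f t‖ ≤ C) :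
    f =O[cocompact ℝ] fun t => |t| ^ (-2 : ℝ) := by
  obtain ⟨C, hC⟩ := hC
  refine IsBigO.of_bound C ?_
  have h0 : ∀ᶠ t : ℝ in cocompact ℝ, t ≠ 0 := by
    simpa using (isCompact_singleton (x := (0 : ℝ))).compl_mem_cocompact
  filter_upwards [h0] with t ht
  have e : |t| ^ (-2 : ℝ) = (t ^ 2)⁻¹ := by
    rw [Real.rpow_neg (abs_nonneg t), Real.rpow_ofNat, sq_abs]
  rw [e, Real.norm_eq_abs, abs_of_nonneg (by positivity), ← div_eq_mul_inv,
    le_div_iff₀ (by positivity), mul_comm]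
  exact hC t

/-- Fubini for the case τ = 0 of the double integral, followed by the substitution t = ξ/2. -/
theorem integrable_besselKernel (hx : 0 < x) : Integrable (fun ξ => (besselKernel x ξ : ℂ)) := by
  have h := coshTempered_oscFactor_mul_zpow 0 0 |>.laplaceIntegrable x hx
  rw [Measure.volume_eq_prod] at h
  have h2 := h.integral_prod_left.comp_mul_left' (R := 1 / 2) (by norm_num)
  refine h2.congr (Eventually.of_forall fun ξ => ?_)
  simp only [besselKernel, oscFactor, zpow_zero, mul_one, Complex.ofReal_zero, mul_zero, zero_mul,
    Complex.exp_zero, one_mul, integral_complex_ofReal]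
  rw [one_div_mul_eq_div]

/-- Fubini, with the factor 2 coming from ξ = 2t. -/
theorem integral_besselKernel_mul_exp (hx : 0 < x) (τ : ℝ) :
    ∫ ξ : ℝ, (besselKernel x ξ : ℂ) * Complex.exp (Complex.I * τ * ξ) =
      2 * coshIntegral τ 0 x := by
  have h := coshTempered_oscFactor_mul_zpow τ 0 |>.laplaceIntegrable x hx
  rw [Measure.volume_eq_prod] at h
  have h1 := Measure.integral_comp_mul_left
    (fun ξ : ℝ => (besselKernel x ξ : ℂ) * Complex.exp (Complex.I * τ * ξ)) 2
  rw [coshIntegral, laplaceIntegral, Measure.volume_eq_prod, integral_prod _ h]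
  have h2 : ∀ t : ℝ, ∫ v : ℝ, oscFactor τ (t, v) * (coshExponent (t, v) : ℂ) ^ (0 : ℤ) *
      (Real.exp (-(x * coshExponent (t, v))) : ℂ) =
      (besselKernel x (2 * t) : ℂ) * Complex.exp (Complex.I * τ * (2 * t : ℝ)) := by
    intro t
    simp only [oscFactor, zpow_zero, mul_one, integral_const_mul, integral_complex_ofReal,
      besselKernel]
    rw [mul_div_cancel_left₀ _ (two_ne_zero : (2 : ℝ) ≠ 0), mul_comm]
    congr 2
    push_cast
    ring
  simp only [h2]
  rw [h1, Complex.real_smul, abs_of_pos (by norm_num), Complex.ofReal_inv, Complex.ofReal_ofNat,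
    mul_inv_cancel_left₀ two_ne_zero]

theorem continuous_coshIntegral (hx : 0 < x) : Continuous (fun τ => coshIntegral τ 0 x) := by
  have c1 := continuous_coshExponent
  refine continuous_of_dominated (bound := fun z => ‖(Real.exp (-(x * coshExponent z)) : ℂ)‖)
    (fun τ => ?_) (fun τ => Eventually.of_forall fun z => ?_) ?_ (Eventually.of_forall fun z => ?_)
  · exact ((coshTempered_oscFactor_mul_zpow τ 0).laplaceIntegrable x hx).1
  · rw [norm_mul, norm_mul, norm_oscFactor, zpow_zero, norm_one, one_mul, one_mul]
  · simpa using ((CoshTempered.const 1).laplaceIntegrable x hx).norm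
  · simp only [oscFactor, zpow_zero, mul_one]
    fun_prop

theorem coshIntegral_bounded (x : ℝ) : ∃ B, ∀ τ, ‖coshIntegral τ 0 x‖ ≤ B := by
  refine ⟨∫ z, ‖(Real.exp (-(x * coshExponent z)) : ℂ)‖, fun τ => ?_⟩
  refine (norm_integral_le_integral_norm _).trans_eq (integral_congr_ae (Eventually.of_forall
    fun z => ?_))
  simp only [norm_mul, norm_oscFactor, zpow_zero, norm_one, one_mul]

theorem integrable_coshIntegral (hx : 0 < x) : Integrable (fun τ => coshIntegral τ 0 x) :=
  integrable_of_sq_mul_norm_le (continuous_coshIntegral hx) (coshIntegral_decay hx)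
    (coshIntegral_bounded x)

theorem coshIntegral_neg (τ : ℝ) (x : ℝ) : coshIntegral (-τ) 0 x = coshIntegral τ 0 x := by
  have h := Measure.integral_comp_smul (volume : Measure (ℝ × ℝ)) (fun z => oscFactor τ z *
      (coshExponent z : ℂ) ^ (0 : ℤ) * (Real.exp (-(x * coshExponent z)) : ℂ)) (-1)
  rw [show Module.finrank ℝ (ℝ × ℝ) = 2 by simp, neg_one_sq, inv_one, abs_one, one_smul] at h
  rw [coshIntegral, laplaceIntegral, coshIntegral, laplaceIntegral, ← h]
  refine integral_congr_ae (Eventually.of_forall fun z => ?_)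
  simp [oscFactor, coshExponent]

theorem fourier_besselKernel (hx : 0 < x) (w : ℝ) :
    𝓕 (fun ξ => (besselKernel x ξ : ℂ)) w = 2 * coshIntegral (-2 * Real.pi * w) 0 x := by
  rw [Real.fourier_real_eq_integral_exp_smul, ← integral_besselKernel_mul_exp hx]
  refine integral_congr_ae (Eventually.of_forall fun ξ => ?_)
  simp only [smul_eq_mul]
  rw [mul_comm]
  congr 2
  push_cast
  ring

/-- Fourier inversion for the continuous, integrable kernel; its transform is integrable by the τ⁻²
decay. Rescaling the frequency by -2π turns the constant into π. -/
theorem integral_coshIntegral_mul_exp (hx : 0 < x) (ξ : ℝ) :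
    ∫ τ : ℝ, coshIntegral τ 0 x * Complex.exp (-Complex.I * τ * ξ) =
      Real.pi * (besselKernel x ξ : ℂ) := by
  have hpi : (-2 * Real.pi) ≠ 0 := by simp [Real.pi_ne_zero]
  have hF : 𝓕 (fun ξ => (besselKernel x ξ : ℂ)) =
      fun w => 2 * coshIntegral (-2 * Real.pi * w) 0 x :=
    funext fun w => fourier_besselKernel hx w
  have hFint : Integrable (𝓕 (fun ξ => (besselKernel x ξ : ℂ))) := by
    rw [hF]
    exact ((integrable_coshIntegral hx).comp_mul_left' hpi).const_mul 2
  have inv := congrFun ((Complex.continuous_ofReal.comp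
    (continuous_besselKernel hx)).fourierInv_fourier_eq (integrable_besselKernel hx) hFint) ξ
  have h1 := Measure.integral_comp_mul_left
    (fun τ : ℝ => coshIntegral τ 0 x * Complex.exp (-Complex.I * τ * ξ)) (-2 * Real.pi)
  have h2 : |(-2 * Real.pi)⁻¹| = (2 * Real.pi)⁻¹ := by
    rw [neg_mul, inv_neg, abs_neg, abs_of_pos (by positivity)]
  rw [h2, Complex.real_smul] at h1
  have h3 : (besselKernel x ξ : ℂ) = 2 * (((2 * Real.pi)⁻¹ : ℝ) : ℂ) *
      ∫ τ : ℝ, coshIntegral τ 0 x * Complex.exp (-Complex.I * τ * ξ) := by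
    rw [mul_assoc, ← h1, ← integral_const_mul]
    refine inv.symm.trans ?_
    change 𝓕⁻ (𝓕 (fun ξ => (besselKernel x ξ : ℂ))) ξ = _
    rw [hF, Real.fourierInv_eq']
    refine integral_congr_ae (Eventually.of_forall fun w => ?_)
    simp only [smul_eq_mul, RCLike.inner_apply, conj_trivial]
    rw [mul_comm, mul_assoc]
    congr 3
    push_cast
    ring
  rw [h3]
  have : (Real.pi : ℂ) ≠ 0 := Complex.ofReal_ne_zero.2 Real.pi_ne_zero
  generalize ∫ τ : ℝ, coshIntegral τ 0 x * Complex.exp (-Complex.I * τ * ξ) = J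
  push_cast
  field_simp

end FourierPair

/-! ### Poisson summation. -/

section Poisson

open MeasureTheory Set Topology FourierTransform

theorem tsum_int_of_even {f : ℤ → ℂ} (he : f.Even) (hs : Summable f) :
    Summable (fun n : ℕ => f (n + 1)) ∧ ∑' n, f n = f 0 + 2 * ∑' n : ℕ, f (n + 1) := by
  have h1 : Summable (fun n : ℕ => f n) :=
    (summable_int_iff_summable_nat_and_neg.1 hs).1
  refine ⟨by simpa using (summable_nat_add_iff 1).2 h1, ?_⟩
  rw [tsum_int_eq_zero_add_two_mul_tsum_pnat he hs,
    tsum_pnat_eq_tsum_succ (f := fun n : ℕ => f n)]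
  simp [two_mul, nsmul_eq_mul]

variable {x : ℝ}

/-- The spacing r = 2π/α is dual to α: the transform of the kernel at rs is (2/r) J at 2πw/r, that
is (α/π) J_{αw}. Inverse-square decay on both sides gives summability and permits Poisson's formula.
-/
theorem poisson_besselKernel (hx : 0 < x) {α : ℝ} (hα : 0 < α) :
    Summable (fun n : ℤ => coshIntegral (α * n) 0 x) ∧
    Summable (fun n : ℤ => (besselKernel x (2 * Real.pi / α * n) : ℂ)) ∧
    ∑' n : ℤ, (besselKernel x (2 * Real.pi / α * n) : ℂ) =
      (α / Real.pi : ℝ) * ∑' n : ℤ, coshIntegral (α * n) 0 x := by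
  have hpi := Real.pi_pos
  have hr : 0 < 2 * Real.pi / α := by positivity
  obtain ⟨r, hrdef⟩ : ∃ r, r = 2 * Real.pi / α := ⟨_, rfl⟩
  rw [← hrdef] at hr ⊢
  have hscale : ∀ {f : ℝ → ℂ} {s : ℝ}, s ≠ 0 → (∃ C, ∀ t, t ^ 2 * ‖f t‖ ≤ C) →
      ∃ C, ∀ t, t ^ 2 * ‖f (s * t)‖ ≤ C := by
    rintro f s hs ⟨C, hC⟩
    refine ⟨C / s ^ 2, fun t => ?_⟩
    rw [le_div_iff₀ (by positivity)]
    calc t ^ 2 * ‖f (s * t)‖ * s ^ 2 = (s * t) ^ 2 * ‖f (s * t)‖ := by ring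
      _ ≤ C := hC _
  have dK : ∃ C, ∀ t, t ^ 2 * ‖(besselKernel x (r * t) : ℂ)‖ ≤ C := by
    refine hscale (f := fun t => (besselKernel x t : ℂ)) hr.ne' ?_
    obtain ⟨C, hC⟩ := besselKernel_decay hx
    refine ⟨C, fun t => ?_⟩
    rw [Complex.norm_real, Real.norm_eq_abs, abs_of_nonneg (besselKernel_nonneg t)]
    exact hC t
  have dJ : ∃ C, ∀ t, t ^ 2 * ‖coshIntegral (α * t) 0 x‖ ≤ C :=
    hscale (f := fun t => coshIntegral t 0 x) hα.ne' (coshIntegral_decay hx)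
  have hF : 𝓕 (fun s => (besselKernel x (r * s) : ℂ)) =
      fun w => (α / Real.pi : ℝ) * coshIntegral (α * w) 0 x := by
    ext w
    -- The Fourier convention produces frequency -αw; evenness of the double integral in τ removes
    -- the sign.
    have h1 := Measure.integral_comp_mul_left (fun ξ : ℝ => (besselKernel x ξ : ℂ) *
      Complex.exp (Complex.I * (-(α * w) : ℝ) * ξ)) r
    rw [integral_besselKernel_mul_exp hx, coshIntegral_neg, abs_of_pos (inv_pos.2 hr),
      Complex.real_smul] at h1
    rw [Real.fourier_real_eq_integral_exp_smul]
    refine Eq.trans (integral_congr_ae (Eventually.of_forall fun s => ?_)) (h1.trans ?_)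
    · simp only [smul_eq_mul]
      rw [mul_comm]
      congr 2
      rw [hrdef]
      have : (α : ℂ) ≠ 0 := Complex.ofReal_ne_zero.2 hα.ne'
      push_cast
      field_simp
    · rw [hrdef, ← mul_assoc]
      congr 1
      push_cast
      field_simp
  have bK := isBigO_cocompact_of_sq_mul_norm_le dK
  have bJ := isBigO_cocompact_of_sq_mul_norm_le dJ
  have bF : 𝓕 (fun s => (besselKernel x (r * s) : ℂ)) =O[cocompact ℝ] fun t => |t| ^ (-2 : ℝ) := by
    rw [hF]
    exact bJ.const_mul_left _
  have hcont : Continuous (fun s => (besselKernel x (r * s) : ℂ)) := by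
    have := continuous_besselKernel hx
    fun_prop
  have key := Real.tsum_eq_tsum_fourier_of_rpow_decay hcont one_lt_two bK bF 0
  refine ⟨summable_of_isBigO (Real.summable_abs_int_rpow one_lt_two)
      (bJ.comp_tendsto Int.tendsto_coe_cofinite),
    summable_of_isBigO (Real.summable_abs_int_rpow one_lt_two)
      (bK.comp_tendsto Int.tendsto_coe_cofinite), ?_⟩
  rw [← tsum_mul_left]
  simpa [hF] using key

theorem besselKernel_neg (x ξ : ℝ) : besselKernel x (-ξ) = besselKernel x ξ := by
  simp [besselKernel, coshExponent, neg_div]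

end Poisson

/-! ### The series identity and the transform pair. -/

theorem corollary8 (x : ℝ) (hx : 0 < x) :
    (∀ α : ℝ, 0 < α →
      Summable (fun n : ℕ =>
        whittakerW (-1 / 4) (Complex.I * (α : ℂ) * ((n : ℂ) + 1)) x *
          whittakerW (1 / 4) (Complex.I * (α : ℂ) * ((n : ℂ) + 1)) x) ∧
      Summable (fun n : ℕ =>
        (Real.exp (-(x / 2) * Real.cosh (Real.pi * ((n : ℝ) + 1) / α)) : ℂ) *
          besselK 0 (x / 2 * Real.cosh (Real.pi * ((n : ℝ) + 1) / α))) ∧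
      whittakerW (-1 / 4) 0 x * whittakerW (1 / 4) 0 x +
          2 * ∑' n : ℕ,
            whittakerW (-1 / 4) (Complex.I * (α : ℂ) * ((n : ℂ) + 1)) x *
              whittakerW (1 / 4) (Complex.I * (α : ℂ) * ((n : ℂ) + 1)) x =
        ((x / (Real.sqrt 2 * α) : ℝ) : ℂ) *
          ((Real.exp (-(x / 2)) : ℂ) * besselK 0 (x / 2) +
            2 * ∑' n : ℕ,
              (Real.exp (-(x / 2) * Real.cosh (Real.pi * ((n : ℝ) + 1) / α)) : ℂ) *
                besselK 0 (x / 2 * Real.cosh (Real.pi * ((n : ℝ) + 1) / α)))) ∧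
    (∀ ξ : ℝ,
      MeasureTheory.Integrable (fun τ : ℝ =>
        whittakerW (-1 / 4) (Complex.I * (τ : ℂ)) x * whittakerW (1 / 4) (Complex.I * (τ : ℂ)) x *
          Complex.exp (-Complex.I * (τ : ℂ) * (ξ : ℂ))) ∧
      (∫ τ : ℝ,
        whittakerW (-1 / 4) (Complex.I * (τ : ℂ)) x * whittakerW (1 / 4) (Complex.I * (τ : ℂ)) x *
          Complex.exp (-Complex.I * (τ : ℂ) * (ξ : ℂ))) =
        ((x / Real.sqrt 2 : ℝ) : ℂ) *
          ((Real.exp (-(x / 2) * Real.cosh (ξ / 2)) : ℂ) *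
            besselK 0 (x / 2 * Real.cosh (ξ / 2)))) ∧
    (∀ τ : ℝ,
      MeasureTheory.Integrable (fun ξ : ℝ =>
        (Real.exp (-(x / 2) * Real.cosh (ξ / 2)) : ℂ) * besselK 0 (x / 2 * Real.cosh (ξ / 2)) *
          Complex.exp (Complex.I * (τ : ℂ) * (ξ : ℂ))) ∧
      whittakerW (-1 / 4) (Complex.I * (τ : ℂ)) x * whittakerW (1 / 4) (Complex.I * (τ : ℂ)) x =
        ((x / (2 * Real.sqrt 2 * Real.pi) : ℝ) : ℂ) *
          ∫ ξ : ℝ,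
            (Real.exp (-(x / 2) * Real.cosh (ξ / 2)) : ℂ) * besselK 0 (x / 2 * Real.cosh (ξ / 2)) *
              Complex.exp (Complex.I * (τ : ℂ) * (ξ : ℂ))) := by
  have hpi : (Real.pi : ℂ) ≠ 0 := Complex.ofReal_ne_zero.2 Real.pi_ne_zero
  have hsqrt : ((√2 : ℝ) : ℂ) ≠ 0 := Complex.ofReal_ne_zero.2 (by positivity)
  refine ⟨fun α hα => ?_, fun ξ => ?_, fun τ => ?_⟩
  · have hα' : (α : ℂ) ≠ 0 := Complex.ofReal_ne_zero.2 hα.ne'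
    obtain ⟨sJ, sK, hP⟩ := poisson_besselKernel hx hα
    obtain ⟨sJ', tJ⟩ := tsum_int_of_even (f := fun n : ℤ => coshIntegral (α * n) 0 x)
      (fun n => by simp only [Int.cast_neg, mul_neg, coshIntegral_neg]) sJ
    obtain ⟨sK', tK⟩ := tsum_int_of_even
      (f := fun n : ℤ => (besselKernel x (2 * Real.pi / α * n) : ℂ))
      (fun n => by simp only [Int.cast_neg, mul_neg, besselKernel_neg]) sK
    have eW : ∀ n : ℕ, whittakerW (-1 / 4) (Complex.I * (α : ℂ) * ((n : ℂ) + 1)) x *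
        whittakerW (1 / 4) (Complex.I * (α : ℂ) * ((n : ℂ) + 1)) x =
        ((x / (√2 * Real.pi) : ℝ) : ℂ) * coshIntegral (α * ((n + 1 : ℤ) : ℝ)) 0 x := by
      intro n
      rw [← whittakerW_mul_whittakerW _ hx]
      push_cast
      rw [mul_assoc]
    have eK : ∀ n : ℕ, (Real.exp (-(x / 2) * Real.cosh (Real.pi * ((n : ℝ) + 1) / α)) : ℂ) *
        besselK 0 (x / 2 * Real.cosh (Real.pi * ((n : ℝ) + 1) / α)) =
        (besselKernel x (2 * Real.pi / α * ((n + 1 : ℤ) : ℝ)) : ℂ) := by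
      intro n
      rw [← besselKernel_eq]
      -- The kernel's argument is ξ/2, so lattice points 2πn/α appear as πn/α inside cosh.
      have : 2 * Real.pi / α * ((n + 1 : ℤ) : ℝ) / 2 = Real.pi * ((n : ℝ) + 1) / α := by
        push_cast
        ring
      rw [this]
    have eW0 : whittakerW (-1 / 4) 0 x * whittakerW (1 / 4) 0 x =
        ((x / (√2 * Real.pi) : ℝ) : ℂ) * coshIntegral (α * ((0 : ℤ) : ℝ)) 0 x := by
      rw [← whittakerW_mul_whittakerW _ hx]
      simp
    have eK0 : (Real.exp (-(x / 2)) : ℂ) * besselK 0 (x / 2) =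
        (besselKernel x (2 * Real.pi / α * ((0 : ℤ) : ℝ)) : ℂ) := by
      rw [← besselKernel_eq]
      simp
    simp only [eW, eK, eW0, eK0]
    refine ⟨sJ'.mul_left _, sK', ?_⟩
    -- Poisson's factor α/π converts x/(√2 α) into the product formula's x/(√2 π).
    rw [← tK, hP, tJ, tsum_mul_left]
    push_cast
    field_simp
  · have e : ∀ τ : ℝ, whittakerW (-1 / 4) (Complex.I * (τ : ℂ)) x *
        whittakerW (1 / 4) (Complex.I * (τ : ℂ)) x * Complex.exp (-Complex.I * (τ : ℂ) * (ξ : ℂ)) =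
        ((x / (√2 * Real.pi) : ℝ) : ℂ) *
          (coshIntegral τ 0 x * Complex.exp (-Complex.I * (τ : ℂ) * (ξ : ℂ))) := fun τ => by
      rw [whittakerW_mul_whittakerW τ hx, mul_assoc]
    simp only [e]
    constructor
    · refine MeasureTheory.Integrable.const_mul ?_ _
      refine (integrable_coshIntegral hx).mul_bdd (c := 1)
        (Continuous.aestronglyMeasurable (by fun_prop)) (Eventually.of_forall fun τ => ?_)
      rw [show -Complex.I * (τ : ℂ) * (ξ : ℂ) = ((-(τ * ξ) : ℝ) : ℂ) * Complex.I by
        push_cast; ring, Complex.norm_exp_ofReal_mul_I]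
    · rw [MeasureTheory.integral_const_mul, integral_coshIntegral_mul_exp hx, besselKernel_eq]
      push_cast
      field_simp
  · simp only [besselKernel_eq]
    constructor
    · refine (integrable_besselKernel hx).mul_bdd (c := 1)
        (Continuous.aestronglyMeasurable (by fun_prop)) (Eventually.of_forall fun ξ => ?_)
      rw [show Complex.I * (τ : ℂ) * (ξ : ℂ) = ((τ * ξ : ℝ) : ℂ) * Complex.I by
        push_cast; ring, Complex.norm_exp_ofReal_mul_I]
    · rw [whittakerW_mul_whittakerW τ hx, integral_besselKernel_mul_exp hx]
      push_cast
      field_simp
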